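/- Let $\alpha>0$, $m=\lceil\alpha\rceil$, $t_0<T$, and let $\|\cdot\|$ be any norm on $\mathbb R^q$. Let $f:[t_0,T]\times\mathbb R^q\to\mathbb R^q$ be twice continuously differentiable and Lipschitz in its second variable, $\|f(t,u)-f(t,v)\|\le L\|u-v\|$ for all $t\in[t_0,T]$ and $u,v\in\mathbb R^q$. Let $y:[t_0,T]\to\mathbb R^q$ be a solution of the Caputo initial value problem $${}^C\!D^\alpha_{t_0}y(t)=f(t,y(t))\quad (t_0<t\le T),\qquad y^{(k)}(t_0)=y_{0,k},\quad k=0,\dots,m-1,$$ where ${}^C\!D^\alpha_{t_0}y=I_{t_0}^{m-\alpha}y^{(m)}$, $I_{t_0}^{\beta}g(t)=\frac1{\Gamma(\beta)}\int_{t_0}^t(t-s)^{\beta-1}g(s)\,ds$ for $\beta>0$, and $I^0_{t_0}$ is the identity. By a solution we mean that $y\in C^{m-1}[t_0,T]$, that $y^{(m)}$ exists on $(t_0,T]$ and is integrable, and that the integrals in the equation exist. On a (not necessarily uniform) grid $t_0<t_1<\dots<t_N=T$ with steps $h_j=t_{j+1}-t_j$, let $y_0=y_{0,0}$ and let $y_1,\dots,y_N$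 satisfy the implicit product-integration trapezoidal rule $$y_n=\sum_{k=0}^{m-1}\frac{(t_n-t_0)^k}{k!}y_{0,k}+w_n f(t_0,y_0)+\sum_{j=1}^n b_{n,j}f(t_j,y_j),\qquad 1\le n\le N,$$ where, with $I^{(k)}_{n,j}=\frac{(t_n-t_j)^{\alpha+k}}{\Gamma(\alpha+k+1)}$, $$w_n=I^{(0)}_{n,0}-\frac{I^{(1)}_{n,0}-I^{(1)}_{n,1}}{h_0},\qquad b_{n,j}=\frac{I^{(1)}_{n,j-1}-I^{(1)}_{n,j}}{h_{j-1}}-\frac{I^{(1)}_{n,j}-I^{(1)}_{n,j+1}}{h_j}\ (1\le j<n),\qquad b_{n,n}=\frac{I^{(1)}_{n,n-1}}{h_{n-1}}.$$ Let $\bar h>0$ satisfy $L\,\bar h^{\alpha}<\Gamma(\alpha+2)$. Then there is a constant $C$, independent of the grid, of $N$, of $n$ and of the numerical solution, such that for all $1\le n\le N$ with $h:=\max_{0\le j\le n-1}h_j\le\bar h$, $$\|y(t_n)-y_n\|\le C\bigl((t_n-t_0)^{\alpha-1}h^{1+\alpha}+h^2\bigr).$$ Consequently, if $0<\alpha<1$,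 then for every $\delta>0$ there is a constant $C_\delta$, also independent of the grid, $N$, $n$ and the numerical solution, such that $\|y(t_n)-y_n\|\le C_\delta\,h^{1+\alpha}$ for all such $n$ with $t_n\ge t_0+\delta$. -/

import Mathlib

noncomputable section

namespace FracTrap

open MeasureTheory Set

variable {E : Type*} [NormedAddCommGroup E] [NormedSpace ℝ E]

/-- The Riemann-Liouville integral of order `β ≥ 0` with base point `t₀`, evaluated at `t`:
`(1 / Γ(β)) ∫_{t₀}^{t} (t - s)^(β - 1) g(s) ds` for `β > 0`, and the identity for `β = 0`. -/
def rlIntegral (β t₀ : ℝ) (g : ℝ → E) (t : ℝ) : E :=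
  if β = 0 then g t
  else (Real.Gamma β)⁻¹ • ∫ s in t₀..t, (t - s) ^ (β - 1) • g s

/-- The integrand of the Riemann-Liouville integral of order `β` at `t` is integrable
(no condition for `β = 0`, where the operator is the identity). -/
def RLIntegrable (β t₀ : ℝ) (g : ℝ → E) (t : ℝ) : Prop :=
  β ≠ 0 → IntervalIntegrable (fun s => (t - s) ^ (β - 1) • g s) volume t₀ t

/-- The classical derivative of order `k` of a function on `[t₀, T]` (one-sided at endpoints). -/
def derivOn (t₀ T : ℝ) (k : ℕ) (y : ℝ → E) : ℝ → E :=
  iteratedDerivWithin k y (Icc t₀ T)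

/-- The Caputo derivative of order `α > 0` of a function on `[t₀, T]`: with `m = ⌈α⌉`, the
Riemann-Liouville integral of order `m - α` of the classical derivative of order `m`. -/
def caputoDeriv (α t₀ T : ℝ) (y : ℝ → E) (t : ℝ) : E :=
  rlIntegral ((⌈α⌉₊ : ℝ) - α) t₀ (derivOn t₀ T ⌈α⌉₊ y) t

/-- `y` solves on `[t₀, T]` the initial value problem for the Caputo equation of order `α`,
`D^α y(t) = f(t, y(t))`, `y^(k)(t₀) = y₀ k` for `k = 0, …, m - 1`, where `m = ⌈α⌉`.
The function is of class `C^(m-1)` on `[t₀, T]`, its derivative of order `m` exists on `(t₀, T]`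
(it may be unbounded at `t₀`) and is integrable. -/
structure IsCaputoSolution (α t₀ T : ℝ) (f : ℝ → E → E) (y₀ : ℕ → E) (y : ℝ → E) : Prop where
  contDiffOn : ContDiffOn ℝ ((⌈α⌉₊ - 1 : ℕ) : ℕ∞) y (Icc t₀ T)
  differentiableOn : DifferentiableOn ℝ (derivOn t₀ T (⌈α⌉₊ - 1) y) (Ioc t₀ T)
  intervalIntegrable : IntervalIntegrable (derivOn t₀ T ⌈α⌉₊ y) volume t₀ T
  rlIntegrable : ∀ t ∈ Ioc t₀ T, RLIntegrable ((⌈α⌉₊ : ℝ) - α) t₀ (derivOn t₀ T ⌈α⌉₊ y) t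
  initial : ∀ k < ⌈α⌉₊, derivOn t₀ T k y t₀ = y₀ k
  equation : ∀ t ∈ Ioc t₀ T, caputoDeriv α t₀ T y t = f t (y t)

/-- The Taylor polynomial `T_{m-1}(t) = ∑_{k < m} (t - t₀)^k / k! · y₀ k`, with `m = ⌈α⌉`. -/
def initialTaylor (α t₀ : ℝ) (y₀ : ℕ → E) (t : ℝ) : E :=
  ∑ k ∈ Finset.range ⌈α⌉₊, ((t - t₀) ^ k / (Nat.factorial k : ℝ)) • y₀ k

/-- A grid `t₀ = t 0 < t 1 < ⋯ < t N = T`, not necessarily uniform. -/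
structure IsGrid (t₀ T : ℝ) (N : ℕ) (t : ℕ → ℝ) : Prop where
  left : t 0 = t₀
  right : t N = T
  lt_succ : ∀ j < N, t j < t (j + 1)

/-- The step `h_j = t_{j+1} - t_j`. -/
def step (t : ℕ → ℝ) (j : ℕ) : ℝ := t (j + 1) - t j

/-- The maximum `max_{0 ≤ j ≤ n-1} h_j` of the first `n` steps (for `n ≥ 1`). -/
def maxStep (t : ℕ → ℝ) (n : ℕ) : ℝ := ⨆ j : Fin n, step t j

/-- `I_{n,j}^{(k)} = (t_n - t_j)^(α + k) / Γ(α + k + 1)`. -/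
def moment (α : ℝ) (t : ℕ → ℝ) (k n j : ℕ) : ℝ :=
  (t n - t j) ^ (α + k) / Real.Gamma (α + k + 1)

/-- The weight `w_n` of `f_0`. -/
def weightZero (α : ℝ) (t : ℕ → ℝ) (n : ℕ) : ℝ :=
  moment α t 0 n 0 - moment α t 1 n 0 / step t 0 + moment α t 1 n 1 / step t 0

/-- The weight `b_{n,j}` of `f_j`, for `1 ≤ j ≤ n`. -/
def weight (α : ℝ) (t : ℕ → ℝ) (n j : ℕ) : ℝ :=
  if j = n then moment α t 1 n (n - 1) / step t (n - 1)
  else (moment α t 1 n (j - 1) - moment α t 1 n j) / step t (j - 1)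
    - (moment α t 1 n j - moment α t 1 n (j + 1)) / step t j

/-- `u 0, …, u N` are produced by the (implicit) product-integration trapezoidal rule on the grid
`t 0 < ⋯ < t N`:
`u_n = T_{m-1}(t_n) + w_n f(t_0, u_0) + ∑_{j=1}^{n} b_{n,j} f(t_j, u_j)`, started from the
initial value `u_0 = y₀ 0`. -/
structure IsPITrapezoidal (α : ℝ) (f : ℝ → E → E) (y₀ : ℕ → E) (N : ℕ) (t : ℕ → ℝ)
    (u : ℕ → E) : Prop where
  start : u 0 = y₀ 0
  rule : ∀ n, 1 ≤ n → n ≤ N →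
    u n = initialTaylor α (t 0) y₀ (t n) + weightZero α t n • f (t 0) (u 0)
      + ∑ j ∈ Finset.Icc 1 n, weight α t n j • f (t j) (u j)

end FracTrap

end

/-!
The proof compares the numerical solution with the Volterra equation `y = T_{m-1} + I^α f(·, y)`,
which follows from the Caputo problem by Taylor's formula and the composition rule for fractional
integrals (`IsCaputoSolution.volterra`). After translation to the initial point `0`, set
`g(s) = f(s, y(s))`. The trapezoidal rule integrates the piecewise linear interpolant of `g`
exactly against the kernel, so its error has two sources.

**Truncation.** The interpolation error of `g` is controlled without differentiating `y`. The
dilations `t ↦ y(l t)`, `l ∈ [1/2, 1]`, all solve a Volterra equation on the same interval, in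
which `l` enters smoothly: `y(l t) = P(l t) + l^α I^α[g(l ·)](t)`. A Gronwall argument therefore
bounds first and second differences in `l`, by `O(|Δl| t^β)` with `β = min(α, 1)` and by
`O(|Δl|² t^γ)` with `γ = min(α, 2)` (and `γ = 2` for `α = 1`, where `l^α` is affine). With
`l = a / b` and `t = b` this says that on an interval `[a, b]` with `b ≤ 2 a` the interpolation
error is `O((b - a)² b^(γ - 2))` (`IsSmoothVolterra.exists_rhs_secondDiff_bound`); near `0` the
Hölder bound `O(s^β)` suffices. Integration against the kernel gives a truncation error of size
`V(s) = (s + h)^(β - 1) h^(1 + β) + h²`, the error profile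
(`IsSmoothVolterra.exists_truncation_bound`). The shift `s + h` makes `V` comparable to its values
at neighbouring grid points, however irregular the grid is.

**Propagation.** The errors `e_k` satisfy
`e_k ≤ C₀ V_k + L ∑ (A_{kj} e_j + B_{kj} e_{j+1})` with the nonnegative half-hat weights `A`, `B`. On a stretch of the grid of length `d` the sum maps `V` to
at most `K d^α V`, so it contracts on windows of a fixed small length. Steps need not be small: the
hypothesis `L hbar^α < Γ(α + 2)` only makes the implicit coefficient `L B_{k,k-1}` less than `1`,
so a single step, of any admissible length, multiplies the bound by a constant. Each window thus
costs two such factors, and the number of windows depends on the length of the interval only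
(`exists_discrete_gronwall_bound`).
-/

namespace FracTrap

open MeasureTheory Set

/-! ### Integrals of the weakly singular kernel -/

section Kernel

theorem intervalIntegrable_kernel {α : ℝ} (hα : 0 < α) (x a b : ℝ) :
    IntervalIntegrable (fun s => (x - s) ^ (α - 1)) volume a b := by
  have h := (intervalIntegral.intervalIntegrable_rpow' (a := x - a) (b := x - b)
    (r := α - 1) (by linarith)).comp_sub_left x
  simpa using h

theorem integral_kernel {α : ℝ} (hα : 0 < α) (x a b : ℝ) :
    ∫ s in a..b, (x - s) ^ (α - 1) = ((x - a) ^ α - (x - b) ^ α) / α := by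
  rw [intervalIntegral.integral_comp_sub_left (fun u => u ^ (α - 1)) x,
    integral_rpow (Or.inl (by linarith))]
  simp

/-- The Beta integral on an arbitrary interval. -/
theorem integral_beta {a b : ℝ} (ha : 0 < a) (hb : 0 < b) {r t : ℝ} (hrt : r < t) :
    ∫ s in r..t, (t - s) ^ (a - 1) * (s - r) ^ (b - 1)
      = Real.Gamma a * Real.Gamma b / Real.Gamma (a + b) * (t - r) ^ (a + b - 1) := by
  have hpos : 0 < t - r := sub_pos.2 hrt
  have h1 : ∫ s in r..t, (t - s) ^ (a - 1) * (s - r) ^ (b - 1)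
      = ∫ x in (0 : ℝ)..(t - r), x ^ (b - 1) * ((t - r) - x) ^ (a - 1) := by
    have := intervalIntegral.integral_comp_sub_right (a := r) (b := t)
      (fun x : ℝ => x ^ (b - 1) * ((t - r) - x) ^ (a - 1)) r
    rw [sub_self] at this
    rw [← this]
    refine intervalIntegral.integral_congr fun s _ => ?_
    simp only [sub_sub_sub_cancel_right]
    ring
  have h2 := Complex.betaIntegral_scaled (b : ℂ) (a : ℂ) hpos
  have h3 : ((∫ x in (0 : ℝ)..(t - r), x ^ (b - 1) * ((t - r) - x) ^ (a - 1) : ℝ) : ℂ)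
      = ∫ x in (0 : ℝ)..(t - r), (x : ℂ) ^ ((b : ℂ) - 1) *
          (((t - r : ℝ) : ℂ) - x) ^ ((a : ℂ) - 1) := by
    rw [← intervalIntegral.integral_ofReal]
    refine intervalIntegral.integral_congr fun x hx => ?_
    rw [uIcc_of_le hpos.le] at hx
    simp only [Complex.ofReal_mul]
    rw [Complex.ofReal_cpow hx.1, Complex.ofReal_cpow (sub_nonneg.2 hx.2)]
    push_cast
    rfl
  have h4 : Complex.betaIntegral (b : ℂ) (a : ℂ)
      = ((Real.Gamma a * Real.Gamma b / Real.Gamma (a + b) : ℝ) : ℂ) := by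
    rw [Complex.betaIntegral_eq_Gamma_mul_div _ _ (by simpa) (by simpa), ← Complex.ofReal_add,
      Complex.Gamma_ofReal, Complex.Gamma_ofReal, Complex.Gamma_ofReal, add_comm b a]
    push_cast
    ring
  rw [h1]
  apply Complex.ofReal_injective
  rw [h3, h2, h4, Complex.ofReal_mul, Complex.ofReal_cpow hpos.le, mul_comm]
  push_cast
  rw [add_comm (b : ℂ)]

theorem intervalIntegrable_beta {a b : ℝ} (ha : 0 < a) (hb : 0 < b) {r t : ℝ} (hrt : r < t) :
    IntervalIntegrable (fun s => (t - s) ^ (a - 1) * (s - r) ^ (b - 1)) volume r t := by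
  -- otherwise the integral would have the junk value `0`
  by_contra h
  have h0 := intervalIntegral.integral_undef h
  rw [integral_beta ha hb hrt] at h0
  have : 0 < Real.Gamma a * Real.Gamma b / Real.Gamma (a + b) * (t - r) ^ (a + b - 1) := by
    have := Real.Gamma_pos_of_pos ha
    have := Real.Gamma_pos_of_pos hb
    have := Real.Gamma_pos_of_pos (add_pos ha hb)
    have := Real.rpow_pos_of_pos (sub_pos.2 hrt) (a + b - 1)
    positivity
  exact this.ne' h0

variable {E : Type*} [NormedAddCommGroup E] [NormedSpace ℝ E]

/-- The composition rule for the (unnormalised) fractional integrals. When `a + b ≥ 1` the kernel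
of order `a + b` is bounded, so that Fubini's theorem applies at every point `t` and not only at
almost every one. -/
theorem integral_kernel_integral_kernel [CompleteSpace E] {a b : ℝ} (ha : 0 < a) (hb : 0 < b)
    (hab : 1 ≤ a + b) {t₀ t : ℝ} (ht : t₀ ≤ t) {g : ℝ → E}
    (hg : IntervalIntegrable g volume t₀ t) :
    ∫ s in t₀..t, (t - s) ^ (a - 1) • ∫ r in t₀..s, (s - r) ^ (b - 1) • g r
      = (Real.Gamma a * Real.Gamma b / Real.Gamma (a + b)) •
        ∫ r in t₀..t, (t - r) ^ (a + b - 1) • g r := by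
  set B := Real.Gamma a * Real.Gamma b / Real.Gamma (a + b) with hB
  -- the integrand on the square, cut off outside the triangle `r < s`
  let k : ℝ → ℝ → ℝ := fun s r => if r < s then (t - s) ^ (a - 1) * (s - r) ^ (b - 1) else 0
  have hgI : IntegrableOn g (Ioc t₀ t) volume :=
    (intervalIntegrable_iff_integrableOn_Ioc_of_le ht).1 hg
  have hk_meas : Measurable (Function.uncurry k) := by
    refine Measurable.ite (measurableSet_lt measurable_snd measurable_fst) ?_ measurable_const
    fun_prop
  have hk_nonneg : ∀ s ∈ Ioc t₀ t, ∀ r, 0 ≤ k s r := by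
    intro s hs r
    simp only [k]
    split_ifs with h
    · exact mul_nonneg (Real.rpow_nonneg (sub_nonneg.2 hs.2) _)
        (Real.rpow_nonneg (sub_nonneg.2 h.le) _)
    · exact le_rfl
  have hk_ind : ∀ r ∈ Ioc t₀ t, (fun s => k s r) =
      (Ioi r).indicator (fun s => (t - s) ^ (a - 1) * (s - r) ^ (b - 1)) := by
    intro r _
    funext s
    simp only [k, indicator, mem_Ioi]
  have hset : ∀ r ∈ Ioc t₀ t, Ioc t₀ t ∩ Ioi r = Ioc r t := by
    intro r hr
    ext s
    simp only [mem_inter_iff, mem_Ioc, mem_Ioi]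
    constructor
    · rintro ⟨⟨_, h2⟩, h3⟩
      exact ⟨h3, h2⟩
    · rintro ⟨h1, h2⟩
      exact ⟨⟨hr.1.trans h1, h2⟩, h1⟩
  have hk_int : ∀ r ∈ Ioo t₀ t, IntegrableOn (fun s => k s r) (Ioc t₀ t) volume := by
    intro r hr
    have hr' : r ∈ Ioc t₀ t := ⟨hr.1, hr.2.le⟩
    rw [hk_ind r hr', IntegrableOn, integrable_indicator_iff measurableSet_Ioi, IntegrableOn,
      Measure.restrict_restrict measurableSet_Ioi, inter_comm, hset r hr']
    exact (intervalIntegrable_iff_integrableOn_Ioc_of_le hr.2.le).1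
      (intervalIntegrable_beta ha hb hr.2)
  have hk_val : ∀ r ∈ Ioo t₀ t, ∫ s in Ioc t₀ t, k s r = B * (t - r) ^ (a + b - 1) := by
    intro r hr
    have hr' : r ∈ Ioc t₀ t := ⟨hr.1, hr.2.le⟩
    rw [hk_ind r hr', setIntegral_indicator measurableSet_Ioi, hset r hr',
      ← intervalIntegral.integral_of_le hr.2.le, integral_beta ha hb hr.2]
  have hIoo : ∀ᵐ r ∂(volume.restrict (Ioc t₀ t)), r ∈ Ioo t₀ t := by
    rw [← restrict_Ioo_eq_restrict_Ioc]
    exact ae_restrict_mem measurableSet_Ioo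
  have hbdd : IntegrableOn (fun r => (t - r) ^ (a + b - 1) • g r) (Ioc t₀ t) volume := by
    refine (intervalIntegrable_iff_integrableOn_Ioc_of_le ht).1 ?_
    refine hg.continuousOn_smul ?_
    exact Continuous.continuousOn
      ((continuous_const.sub continuous_id).rpow_const fun x => Or.inr (by linarith))
  have hprod : Integrable (Function.uncurry fun s r => k s r • g r)
      ((volume.restrict (Ioc t₀ t)).prod (volume.restrict (Ioc t₀ t))) := by
    have hms : AEStronglyMeasurable (Function.uncurry fun s r => k s r • g r)
        ((volume.restrict (Ioc t₀ t)).prod (volume.restrict (Ioc t₀ t))) := by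
      exact (hk_meas.aestronglyMeasurable).smul hgI.aestronglyMeasurable.comp_snd
    rw [integrable_prod_iff' hms]
    constructor
    · filter_upwards [hIoo] with r hr
      exact (hk_int r hr).smul_const (g r)
    · have : (fun r => ∫ s in Ioc t₀ t, ‖k s r • g r‖) =ᵐ[volume.restrict (Ioc t₀ t)]
          fun r => B * ‖(t - r) ^ (a + b - 1) • g r‖ := by
        filter_upwards [hIoo] with r hr
        have h1 : ∫ s in Ioc t₀ t, ‖k s r • g r‖ = ∫ s in Ioc t₀ t, k s r * ‖g r‖ := by
          refine setIntegral_congr_fun measurableSet_Ioc fun s hs => ?_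
          simp only [norm_smul, Real.norm_of_nonneg (hk_nonneg s hs r)]
        rw [h1, integral_mul_const, hk_val r hr, norm_smul,
          Real.norm_of_nonneg (Real.rpow_nonneg (sub_nonneg.2 hr.2.le) _), mul_assoc]
      exact (integrable_congr this).2 (hbdd.norm.const_mul B)
  have hswap := integral_integral_swap hprod
  rw [intervalIntegral.integral_of_le ht, intervalIntegral.integral_of_le ht]
  have hL : ∫ s in Ioc t₀ t, (t - s) ^ (a - 1) • ∫ r in t₀..s, (s - r) ^ (b - 1) • g r
      = ∫ s in Ioc t₀ t, ∫ r in Ioc t₀ t, k s r • g r := by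
    refine setIntegral_congr_fun measurableSet_Ioc fun s hs => ?_
    have hkr : (fun r => k s r • g r) = (Iio s).indicator
        (fun r => (t - s) ^ (a - 1) • (s - r) ^ (b - 1) • g r) := by
      funext r
      simp only [k, indicator, mem_Iio]
      split_ifs
      · rw [mul_smul]
      · rw [zero_smul]
    have hset' : Ioc t₀ t ∩ Iio s = Ioo t₀ s := by
      ext r
      simp only [mem_inter_iff, mem_Ioc, mem_Iio, mem_Ioo]
      constructor
      · rintro ⟨⟨h1, _⟩, h3⟩
        exact ⟨h1, h3⟩
      · rintro ⟨h1, h2⟩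
        exact ⟨⟨h1, h2.le.trans hs.2⟩, h2⟩
    simp only [hkr]
    rw [setIntegral_indicator measurableSet_Iio, hset', ← integral_Ioc_eq_integral_Ioo,
      integral_smul, intervalIntegral.integral_of_le hs.1.le]
  have hR : ∫ r in Ioc t₀ t, ∫ s in Ioc t₀ t, k s r • g r
      = ∫ r in Ioc t₀ t, B • (t - r) ^ (a + b - 1) • g r := by
    refine integral_congr_ae ?_
    filter_upwards [hIoo] with r hr
    rw [integral_smul_const, hk_val r hr, mul_smul]
  rw [hL, hswap, hR, integral_smul]

end Kernel

/-! ### The Volterra equation -/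

section Volterra

variable {E : Type*} [NormedAddCommGroup E] [NormedSpace ℝ E]

theorem integral_pow_div_factorial (t₀ t : ℝ) (i : ℕ) :
    ∫ s in t₀..t, (s - t₀) ^ i / (Nat.factorial i : ℝ)
      = (t - t₀) ^ (i + 1) / (Nat.factorial (i + 1) : ℝ) := by
  rw [intervalIntegral.integral_div,
    intervalIntegral.integral_comp_sub_right (fun u => u ^ i) t₀, integral_pow]
  rw [Nat.factorial_succ]
  push_cast
  have : (Nat.factorial i : ℝ) ≠ 0 := by exact_mod_cast (Nat.factorial_pos i).ne'
  field_simp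
  simp

/-- Taylor's formula with integral remainder for a chain `D 0, D 1, …, D m` of functions each of
which is the primitive of the next one; nothing but integrability is asked of `D m`. -/
theorem taylor_integral_remainder [CompleteSpace E] {t₀ T : ℝ} (m : ℕ) (D : ℕ → ℝ → E)
    (hint : ∀ k ≤ m, IntervalIntegrable (D k) volume t₀ T)
    (hftc : ∀ k < m, ∀ t ∈ Icc t₀ T, D k t = D k t₀ + ∫ s in t₀..t, D (k + 1) s) :
    ∀ j k : ℕ, k + (j + 1) = m → ∀ t ∈ Icc t₀ T,
      D k t = ∑ i ∈ Finset.range (j + 1), ((t - t₀) ^ i / (Nat.factorial i : ℝ)) • D (k + i) t₀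
        + (Real.Gamma ((j + 1 : ℕ) : ℝ))⁻¹ •
          ∫ s in t₀..t, (t - s) ^ (((j + 1 : ℕ) : ℝ) - 1) • D m s := by
  have hsub : ∀ t ∈ Icc t₀ T, ∀ k ≤ m, IntervalIntegrable (D k) volume t₀ t := by
    intro t ht k hk
    refine (hint k hk).mono_set ?_
    rw [uIcc_of_le ht.1, uIcc_of_le (ht.1.trans ht.2)]
    exact Icc_subset_Icc_right ht.2
  intro j
  induction j with
  | zero =>
    intro k hk t ht
    rw [hftc k (by omega) t ht]
    subst hk
    simp
  | succ j ih =>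
    intro k hk t ht
    have hk1 : k + 1 + (j + 1) = m := by omega
    have hrec := ih (k + 1) hk1
    have hpoly : ∀ i, IntervalIntegrable
        (fun s => ((s - t₀) ^ i / (Nat.factorial i : ℝ)) • D (k + 1 + i) t₀) volume t₀ t := by
      intro i
      apply Continuous.intervalIntegrable
      fun_prop
    have h1 : ∫ s in t₀..t, (D (k + 1) s - ∑ i ∈ Finset.range (j + 1),
          ((s - t₀) ^ i / (Nat.factorial i : ℝ)) • D (k + 1 + i) t₀)
        = (Real.Gamma ((j + 1 + 1 : ℕ) : ℝ))⁻¹ •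
          ∫ s in t₀..t, (t - s) ^ (((j + 1 + 1 : ℕ) : ℝ) - 1) • D m s := by
      have hsg := integral_kernel_integral_kernel (a := 1) (b := ((j + 1 : ℕ) : ℝ)) one_pos
        (by positivity) (by linarith [Nat.cast_nonneg (α := ℝ) (j + 1)]) ht.1 (hsub t ht m le_rfl)
      have h2 : ∫ s in t₀..t, (D (k + 1) s - ∑ i ∈ Finset.range (j + 1),
            ((s - t₀) ^ i / (Nat.factorial i : ℝ)) • D (k + 1 + i) t₀)
          = ∫ s in t₀..t, (Real.Gamma ((j + 1 : ℕ) : ℝ))⁻¹ • ((t - s) ^ ((1 : ℝ) - 1) •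
              ∫ r in t₀..s, (s - r) ^ (((j + 1 : ℕ) : ℝ) - 1) • D m r) := by
        refine intervalIntegral.integral_congr fun s hs => ?_
        rw [uIcc_of_le ht.1] at hs
        simp only [sub_self, Real.rpow_zero, one_smul]
        rw [hrec s ⟨hs.1, hs.2.trans ht.2⟩]
        abel
      have hG : Real.Gamma ((j + 1 : ℕ) : ℝ) ≠ 0 :=
        (Real.Gamma_pos_of_pos (by positivity)).ne'
      have hc : (1 : ℝ) + ((j + 1 : ℕ) : ℝ) = ((j + 1 + 1 : ℕ) : ℝ) := by push_cast; ring
      rw [h2, intervalIntegral.integral_smul, hsg, smul_smul, Real.Gamma_one, hc]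
      congr 1
      field_simp
    have hpolysum : IntervalIntegrable (fun s => ∑ i ∈ Finset.range (j + 1),
        ((s - t₀) ^ i / (Nat.factorial i : ℝ)) • D (k + 1 + i) t₀) volume t₀ t := by
      apply Continuous.intervalIntegrable
      fun_prop
    rw [intervalIntegral.integral_sub (hsub t ht (k + 1) (by omega)) hpolysum,
      intervalIntegral.integral_finsetSum fun i _ => hpoly i, sub_eq_iff_eq_add] at h1
    rw [hftc k (by omega) t ht, h1, Finset.sum_range_succ' _ (j + 1)]
    simp only [intervalIntegral.integral_smul_const, integral_pow_div_factorial]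
    simp only [pow_zero, Nat.factorial_zero, Nat.cast_one, div_one, one_smul, add_zero]
    simp only [show ∀ i, k + 1 + i = k + (i + 1) from fun i => by omega]
    abel

/-- A solution of the Caputo initial value problem solves the Volterra equation
`y = T_{m-1} + I^α f(·, y)`. -/
theorem IsCaputoSolution.volterra [CompleteSpace E] {α t₀ T : ℝ} (hα : 0 < α) (hT : t₀ < T)
    {f : ℝ → E → E} {y₀ : ℕ → E} {y : ℝ → E} (hy : IsCaputoSolution α t₀ T f y₀ y)
    {t : ℝ} (ht : t ∈ Icc t₀ T) :
    y t = initialTaylor α t₀ y₀ t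
      + (Real.Gamma α)⁻¹ • ∫ s in t₀..t, (t - s) ^ (α - 1) • f s (y s) := by
  obtain ⟨j, hj⟩ : ∃ j, ⌈α⌉₊ = j + 1 :=
    Nat.exists_eq_succ_of_ne_zero (Nat.ceil_pos.2 hα).ne'
  have hαj : α ≤ ((j + 1 : ℕ) : ℝ) := hj ▸ Nat.le_ceil α
  have hu : UniqueDiffOn ℝ (Icc t₀ T) := uniqueDiffOn_Icc hT
  have hcd := hy.contDiffOn
  rw [hj, Nat.add_sub_cancel] at hcd
  have hcont : ∀ k ≤ j, ContinuousOn (derivOn t₀ T k y) (Icc t₀ T) := by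
    intro k hk
    exact hcd.continuousOn_iteratedDerivWithin (by exact_mod_cast hk) hu
  have hderiv : ∀ k < j + 1, ∀ x ∈ Ioo t₀ T,
      HasDerivAt (derivOn t₀ T k y) (derivOn t₀ T (k + 1) y x) x := by
    intro k hk x hx
    have hd : DifferentiableAt ℝ (derivOn t₀ T k y) x := by
      rcases Nat.lt_succ_iff_lt_or_eq.1 hk with hk' | rfl
      · exact (hcd.differentiableOn_iteratedDerivWithin (by exact_mod_cast hk') hu).differentiableAt
          (Icc_mem_nhds hx.1 hx.2)
      · have := hy.differentiableOn
        rw [hj, Nat.add_sub_cancel] at this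
        exact this.differentiableAt (Ioc_mem_nhds hx.1 hx.2)
    have he : derivOn t₀ T (k + 1) y x = deriv (derivOn t₀ T k y) x := by
      simp only [derivOn]
      rw [iteratedDerivWithin_succ, derivWithin_of_mem_nhds (Icc_mem_nhds hx.1 hx.2)]
    rw [he]
    exact hd.hasDerivAt
  have hint : ∀ k ≤ j + 1, IntervalIntegrable (derivOn t₀ T k y) volume t₀ T := by
    intro k hk
    rcases Nat.le_succ_iff.1 hk with hk' | rfl
    · exact ((hcont k hk').mono (uIcc_of_le hT.le).subset).intervalIntegrable
    · have := hy.intervalIntegrable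
      rwa [hj] at this
  have hftc : ∀ k < j + 1, ∀ x ∈ Icc t₀ T, derivOn t₀ T k y x
      = derivOn t₀ T k y t₀ + ∫ s in t₀..x, derivOn t₀ T (k + 1) y s := by
    intro k hk x hx
    rw [intervalIntegral.integral_eq_sub_of_hasDerivAt_of_le hx.1
      ((hcont k (by omega)).mono (Icc_subset_Icc_right hx.2))
      (fun z hz => hderiv k hk z ⟨hz.1, hz.2.trans_le hx.2⟩)
      ((hint (k + 1) (by omega)).mono_set ?_)]
    · abel
    · rw [uIcc_of_le hx.1, uIcc_of_le hT.le]
      exact Icc_subset_Icc_right hx.2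
  have htay := taylor_integral_remainder (j + 1) (fun k => derivOn t₀ T k y) hint hftc j 0
    (by omega) t ht
  have hy0 : derivOn t₀ T 0 y t = y t := by simp [derivOn]
  have hsum : ∑ i ∈ Finset.range (j + 1),
      ((t - t₀) ^ i / (Nat.factorial i : ℝ)) • derivOn t₀ T (0 + i) y t₀
      = initialTaylor α t₀ y₀ t := by
    rw [initialTaylor, hj]
    refine Finset.sum_congr rfl fun i hi => ?_
    rw [zero_add, hy.initial i (hj ▸ Finset.mem_range.1 hi)]
  rw [hy0, hsum] at htay
  rw [htay]
  congr 1
  have heq : ∀ s ∈ Ioc t₀ t, rlIntegral (((j + 1 : ℕ) : ℝ) - α) t₀ (derivOn t₀ T (j + 1) y) s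
      = f s (y s) := by
    intro s hs
    have := hy.equation s ⟨hs.1, hs.2.trans ht.2⟩
    rwa [caputoDeriv, hj] at this
  rcases hαj.eq_or_lt with h | h
  -- for integer order, the Caputo derivative is the classical one
  · rw [← h]
    congr 1
    refine intervalIntegral.integral_congr_uIoo fun s hs => ?_
    rw [uIoo_of_le ht.1] at hs
    have := heq s ⟨hs.1, hs.2.le⟩
    rw [rlIntegral, if_pos (by rw [← h]; ring)] at this
    simp only [this]
  · have hb : 0 < ((j + 1 : ℕ) : ℝ) - α := by linarith
    have hsg := integral_kernel_integral_kernel (a := α) (b := ((j + 1 : ℕ) : ℝ) - α) hα hb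
      (by push_cast; linarith [Nat.cast_nonneg (α := ℝ) j]) ht.1
      (g := derivOn t₀ T (j + 1) y) ((hint (j + 1) le_rfl).mono_set (by
        rw [uIcc_of_le ht.1, uIcc_of_le hT.le]
        exact Icc_subset_Icc_right ht.2))
    have h2 : ∫ s in t₀..t, (t - s) ^ (α - 1) • f s (y s)
        = ∫ s in t₀..t, (Real.Gamma (((j + 1 : ℕ) : ℝ) - α))⁻¹ • ((t - s) ^ (α - 1) •
          ∫ r in t₀..s, (s - r) ^ (((j + 1 : ℕ) : ℝ) - α - 1) • derivOn t₀ T (j + 1) y r) := by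
      refine intervalIntegral.integral_congr_uIoo fun s hs => ?_
      rw [uIoo_of_le ht.1] at hs
      rw [← heq s ⟨hs.1, hs.2.le⟩, rlIntegral, if_neg hb.ne', smul_comm]
    have hG1 := (Real.Gamma_pos_of_pos hα).ne'
    have hG2 := (Real.Gamma_pos_of_pos hb).ne'
    have hc : α + (((j + 1 : ℕ) : ℝ) - α) = ((j + 1 : ℕ) : ℝ) := by ring
    rw [h2, intervalIntegral.integral_smul, hsg, smul_smul, smul_smul, hc]
    congr 1
    field_simp

end Volterra

/-! ### Second differences of twice continuously differentiable maps -/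

section SecondDifference

variable {X F : Type*} [NormedAddCommGroup X] [NormedSpace ℝ X] [NormedAddCommGroup F]
  [NormedSpace ℝ F]

theorem exists_lipschitz_bound_of_contDiffOn {φ : X → F} {S K : Set X} (hφ : ContDiffOn ℝ 1 φ S)
    (hS : UniqueDiffOn ℝ S) (hK : IsCompact K) (hKc : Convex ℝ K) (hKS : K ⊆ S) :
    ∃ M : ℝ, 0 ≤ M ∧ ∀ x ∈ K, ∀ z ∈ K, ‖φ z - φ x‖ ≤ M * ‖z - x‖ := by
  obtain ⟨M, hM⟩ := hK.exists_bound_of_continuousOn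
    ((hφ.continuousOn_fderivWithin hS le_rfl).mono hKS)
  refine ⟨max M 0, le_max_right _ _, fun x hx z hz => ?_⟩
  refine hKc.norm_image_sub_le_of_norm_hasFDerivWithin_le (f' := fderivWithin ℝ φ S)
    (fun w hw => ?_) (fun w hw => (hM w hw).trans (le_max_left _ _)) hx hz
  exact ((hφ.differentiableOn one_ne_zero w (hKS hw)).hasFDerivWithinAt).mono hKS

/-- The second difference of a `C²` function is quadratic in the size of the segment, uniformly
on compact convex sets. -/
theorem exists_secondDiff_bound_of_contDiffOn {φ : X → F} {S K : Set X} (hφ : ContDiffOn ℝ 2 φ S)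
    (hS : UniqueDiffOn ℝ S) (hK : IsCompact K) (hKc : Convex ℝ K) (hKS : K ⊆ S) :
    ∃ M : ℝ, 0 ≤ M ∧ ∀ x ∈ K, ∀ z ∈ K, ∀ θ η : ℝ, 0 ≤ θ → 0 ≤ η → θ + η = 1 →
      ‖φ (θ • x + η • z) - θ • φ x - η • φ z‖ ≤ M * ‖z - x‖ ^ 2 := by
  obtain ⟨M, hM0, hM⟩ := exists_lipschitz_bound_of_contDiffOn
    (hφ.fderivWithin hS (m := 1) (by norm_num)) hS hK hKc hKS
  -- first order Taylor expansion with quadratic remainder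
  have htaylor : ∀ w ∈ K, ∀ z ∈ K,
      ‖φ z - φ w - fderivWithin ℝ φ S w (z - w)‖ ≤ M * ‖z - w‖ ^ 2 := by
    intro w hw z hz
    have hseg : segment ℝ w z ⊆ K := hKc.segment_subset hw hz
    have := (convex_segment w z).norm_image_sub_le_of_norm_hasFDerivWithin_le'
      (f := φ) (f' := fderivWithin ℝ φ S) (φ := fderivWithin ℝ φ S w) (C := M * ‖z - w‖)
      (fun v hv => ((hφ.differentiableOn two_ne_zero v
        (hKS (hseg hv))).hasFDerivWithinAt).mono (hseg.trans hKS))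
      (fun v hv => (hM w hw v (hseg hv)).trans (mul_le_mul_of_nonneg_left ?_ hM0))
      (left_mem_segment ℝ w z) (right_mem_segment ℝ w z)
    · rw [pow_two, ← mul_assoc]
      exact this
    · obtain ⟨p, q, hp, hq, hpq, rfl⟩ := hv
      have : p • w + q • z - w = q • (z - w) := by
        have : p = 1 - q := by linarith
        subst this
        module
      rw [this, norm_smul, Real.norm_of_nonneg hq]
      exact mul_le_of_le_one_left (norm_nonneg _) (by linarith)
  refine ⟨M, hM0, fun x hx z hz θ η hθ hη hsum => ?_⟩
  have hw : θ • x + η • z ∈ K := hKc hx hz hθ hη hsum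
  set w := θ • x + η • z with hwdef
  set D := fderivWithin ℝ φ S w
  have hη' : η = 1 - θ := by linarith
  have hxw : x - w = η • (x - z) := by
    rw [hwdef, hη']
    module
  have hzw : z - w = θ • (z - x) := by
    rw [hwdef, hη']
    module
  have hkey : φ w - θ • φ x - η • φ z
      = -(θ • (φ x - φ w - D (x - w)) + η • (φ z - φ w - D (z - w))) := by
    have h0 : θ • D (x - w) + η • D (z - w) = 0 := by
      rw [← map_smul, ← map_smul, ← map_add, hxw, hzw]
      rw [show θ • η • (x - z) + η • θ • (z - x) = 0 by module, map_zero]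
    have : φ w = (θ + η) • φ w := by rw [hsum, one_smul]
    calc φ w - θ • φ x - η • φ z = (θ + η) • φ w - θ • φ x - η • φ z
          + (θ • D (x - w) + η • D (z - w)) := by rw [← this, h0, add_zero]
      _ = _ := by module
  have h1 : ‖x - w‖ ≤ ‖z - x‖ := by
    rw [hxw, norm_smul, Real.norm_of_nonneg hη, norm_sub_rev x z]
    exact mul_le_of_le_one_left (norm_nonneg _) (by linarith)
  have h2 : ‖z - w‖ ≤ ‖z - x‖ := by
    rw [hzw, norm_smul, Real.norm_of_nonneg hθ]
    exact mul_le_of_le_one_left (norm_nonneg _) (by linarith)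
  rw [hkey, norm_neg]
  calc ‖θ • (φ x - φ w - D (x - w)) + η • (φ z - φ w - D (z - w))‖
      ≤ θ * (M * ‖x - w‖ ^ 2) + η * (M * ‖z - w‖ ^ 2) := by
        refine (norm_add_le _ _).trans ?_
        rw [norm_smul, norm_smul, Real.norm_of_nonneg hθ, Real.norm_of_nonneg hη]
        exact add_le_add (mul_le_mul_of_nonneg_left (htaylor w hw x hx) hθ)
          (mul_le_mul_of_nonneg_left (htaylor w hw z hz) hη)
    _ ≤ θ * (M * ‖z - x‖ ^ 2) + η * (M * ‖z - x‖ ^ 2) := by gcongr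
    _ = M * ‖z - x‖ ^ 2 := by rw [← add_mul, hsum, one_mul]

end SecondDifference

/-! ### A weakly singular Gronwall inequality -/

section Gronwall

theorem integral_kernel_mul_exp_le {α σ : ℝ} (hα : 0 < α) (hσ : 0 < σ) {t : ℝ} (ht : 0 ≤ t) :
    ∫ s in (0 : ℝ)..t, (t - s) ^ (α - 1) * Real.exp (σ * s)
      ≤ Real.exp (σ * t) * ((1 / σ) ^ α * Real.Gamma α) := by
  have hval := Real.integral_rpow_mul_exp_neg_mul_Ioi hα hσ
  have hpos : 0 < (1 / σ) ^ α * Real.Gamma α :=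
    mul_pos (Real.rpow_pos_of_pos (by positivity) _) (Real.Gamma_pos_of_pos hα)
  have hint : IntegrableOn (fun u : ℝ => u ^ (α - 1) * Real.exp (-(σ * u))) (Ioi 0) := by
    -- otherwise the Gamma integral would have the junk value `0`
    by_contra h
    rw [integral_undef h] at hval
    exact hpos.ne hval
  have h1 : ∫ s in (0 : ℝ)..t, (t - s) ^ (α - 1) * Real.exp (σ * s)
      = Real.exp (σ * t) * ∫ u in (0 : ℝ)..t, u ^ (α - 1) * Real.exp (-(σ * u)) := by
    have := intervalIntegral.integral_comp_sub_left (a := 0) (b := t)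
      (fun u : ℝ => Real.exp (σ * t) * (u ^ (α - 1) * Real.exp (-(σ * u)))) t
    rw [sub_self, sub_zero] at this
    rw [← intervalIntegral.integral_const_mul, ← this]
    refine intervalIntegral.integral_congr fun s _ => ?_
    have : Real.exp (σ * s) = Real.exp (σ * t) * Real.exp (-(σ * (t - s))) := by
      rw [← Real.exp_add]
      ring_nf
    rw [this]
    ring
  rw [h1, ← hval, intervalIntegral.integral_of_le ht]
  refine mul_le_mul_of_nonneg_left ?_ (Real.exp_pos _).le
  refine setIntegral_mono_set hint ?_ Ioc_subset_Ioi_self.eventuallyLE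
  filter_upwards [ae_restrict_mem measurableSet_Ioi] with u hu
  exact mul_nonneg (Real.rpow_nonneg (le_of_lt hu) _) (Real.exp_pos _).le

/-- A Gronwall inequality for the weakly singular kernel `(t - s)^(α - 1)`; the constant does not
depend on the right end point `t'`. -/
theorem exists_gronwall_bound {α c T : ℝ} (hα : 0 < α) (hc : 0 ≤ c) :
    ∃ C : ℝ, 0 ≤ C ∧ ∀ t' ∈ Icc 0 T, ∀ (ζ : ℝ → ℝ) (κ : ℝ), ContinuousOn ζ (Icc 0 t') →
      (∀ t ∈ Icc 0 t', 0 ≤ ζ t) →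
      (∀ t ∈ Icc 0 t', ζ t ≤ κ + c * ∫ s in (0 : ℝ)..t, (t - s) ^ (α - 1) * ζ s) →
      ζ t' ≤ C * κ := by
  have hΓ := Real.Gamma_pos_of_pos hα
  -- with this rate, the integral operator contracts by `1/2` in the weighted supremum norm
  set σ : ℝ := (2 * c * Real.Gamma α + 1) ^ (1 / α) with hσdef
  have hbase : 0 < 2 * c * Real.Gamma α + 1 := by positivity
  have hσ : 0 < σ := Real.rpow_pos_of_pos hbase _
  have hσα : c * ((1 / σ) ^ α * Real.Gamma α) ≤ 1 / 2 := by
    have : (1 / σ) ^ α = 1 / (2 * c * Real.Gamma α + 1) := by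
      rw [Real.div_rpow zero_le_one hσ.le, Real.one_rpow, hσdef, ← Real.rpow_mul hbase.le,
        one_div_mul_cancel hα.ne', Real.rpow_one]
    rw [this, one_div_mul_eq_div, mul_div_assoc', div_le_iff₀ hbase]
    linarith
  refine ⟨2 * Real.exp (σ * T), by positivity, fun t' ht' ζ κ hcont hnonneg hle => ?_⟩
  have hcw : ContinuousOn (fun t => Real.exp (-(σ * t)) * ζ t) (Icc 0 t') := by fun_prop
  -- a maximum point of the exponentially weighted function
  obtain ⟨x, hx, hmax⟩ := isCompact_Icc.exists_isMaxOn (nonempty_Icc.2 ht'.1) hcw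
  set M := Real.exp (-(σ * x)) * ζ x with hM
  have hM0 : 0 ≤ M := mul_nonneg (Real.exp_pos _).le (hnonneg x hx)
  have hζ : ∀ t ∈ Icc 0 t', ζ t ≤ M * Real.exp (σ * t) := by
    intro t ht
    have h : Real.exp (-(σ * t)) * ζ t ≤ M := hmax ht
    calc ζ t = (Real.exp (-(σ * t)) * ζ t) * Real.exp (σ * t) := by
          rw [mul_right_comm, ← Real.exp_add]
          simp
      _ ≤ M * Real.exp (σ * t) := mul_le_mul_of_nonneg_right h (Real.exp_pos _).le
  have hxeq : ζ x = M * Real.exp (σ * x) := by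
    rw [hM, mul_right_comm, ← Real.exp_add]
    simp
  have hI : ∫ s in (0 : ℝ)..x, (x - s) ^ (α - 1) * ζ s
      ≤ M * (Real.exp (σ * x) * ((1 / σ) ^ α * Real.Gamma α)) := by
    refine le_trans ?_ (mul_le_mul_of_nonneg_left (integral_kernel_mul_exp_le hα hσ hx.1) hM0)
    rw [← intervalIntegral.integral_const_mul]
    refine intervalIntegral.integral_mono_on hx.1 ?_ ?_ fun s hs => ?_
    · refine (intervalIntegrable_kernel hα x 0 x).mul_continuousOn ?_
      rw [uIcc_of_le hx.1]
      exact hcont.mono (Icc_subset_Icc_right hx.2)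
    · refine ((intervalIntegrable_kernel hα x 0 x).mul_continuousOn ?_).const_mul M
      fun_prop
    · have h1 := hζ s ⟨hs.1, hs.2.trans hx.2⟩
      have h2 : 0 ≤ (x - s) ^ (α - 1) := Real.rpow_nonneg (sub_nonneg.2 hs.2) _
      calc (x - s) ^ (α - 1) * ζ s ≤ (x - s) ^ (α - 1) * (M * Real.exp (σ * s)) :=
            mul_le_mul_of_nonneg_left h1 h2
        _ = _ := by ring
  have h1 := hle x hx
  have hE : 0 ≤ M * Real.exp (σ * x) := by positivity
  have h2 : M * Real.exp (σ * x) ≤ 2 * κ := by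
    have h3 : c * (M * (Real.exp (σ * x) * ((1 / σ) ^ α * Real.Gamma α)))
        ≤ 1 / 2 * (M * Real.exp (σ * x)) := by
      calc c * (M * (Real.exp (σ * x) * ((1 / σ) ^ α * Real.Gamma α)))
          = (c * ((1 / σ) ^ α * Real.Gamma α)) * (M * Real.exp (σ * x)) := by ring
        _ ≤ _ := mul_le_mul_of_nonneg_right hσα hE
    have h4 := mul_le_mul_of_nonneg_left hI hc
    linarith
  have hMκ : M ≤ 2 * κ := by
    refine le_trans ?_ h2
    exact le_mul_of_one_le_right hM0 (Real.one_le_exp (mul_nonneg hσ.le hx.1))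
  have ht'mem : t' ∈ Icc 0 t' := ⟨ht'.1, le_rfl⟩
  calc ζ t' ≤ M * Real.exp (σ * t') := hζ t' ht'mem
    _ ≤ (2 * κ) * Real.exp (σ * T) := by
      have : Real.exp (σ * t') ≤ Real.exp (σ * T) :=
        Real.exp_le_exp.2 (mul_le_mul_of_nonneg_left ht'.2 hσ.le)
      exact mul_le_mul hMκ this (Real.exp_pos _).le (hM0.trans hMκ)
    _ = _ := by ring

end Gronwall

/-! ### Dilations of a Volterra solution -/

section Scaling

theorem exists_rpow_le_rpow {p q : ℝ} (T : ℝ) (hq : 0 < q) (hqp : q ≤ p) :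
    ∃ C : ℝ, 0 ≤ C ∧ ∀ t ∈ Icc 0 T, t ^ p ≤ C * t ^ q := by
  refine ⟨|T| ^ (p - q), Real.rpow_nonneg (abs_nonneg _) _, fun t ht => ?_⟩
  rcases ht.1.eq_or_lt with rfl | h
  · rw [Real.zero_rpow (by linarith), Real.zero_rpow hq.ne', mul_zero]
  · rw [show p = (p - q) + q by ring, Real.rpow_add h, add_sub_cancel_right]
    exact mul_le_mul_of_nonneg_right
      (Real.rpow_le_rpow h.le (ht.2.trans (le_abs_self T)) (by linarith)) (Real.rpow_nonneg h.le _)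

variable {E : Type*} [NormedAddCommGroup E] [NormedSpace ℝ E]

theorem norm_integral_kernel_smul_le {α : ℝ} (hα : 0 < α) {t : ℝ} (ht : 0 ≤ t) {w : ℝ → E}
    {v : ℝ → ℝ} (hv : ContinuousOn v (Icc 0 t)) (hwv : ∀ s ∈ Icc 0 t, ‖w s‖ ≤ v s) :
    ‖∫ s in (0 : ℝ)..t, (t - s) ^ (α - 1) • w s‖ ≤ ∫ s in (0 : ℝ)..t, (t - s) ^ (α - 1) * v s := by
  refine intervalIntegral.norm_integral_le_of_norm_le ht (Filter.Eventually.of_forall fun s hs => ?_)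
    ((intervalIntegrable_kernel hα t 0 t).mul_continuousOn (by rwa [uIcc_of_le ht]))
  have hk : 0 ≤ (t - s) ^ (α - 1) := Real.rpow_nonneg (sub_nonneg.2 hs.2) _
  rw [norm_smul, Real.norm_of_nonneg hk]
  exact mul_le_mul_of_nonneg_left (hwv s ⟨hs.1.le, hs.2⟩) hk

theorem integral_kernel_mul_affine {α : ℝ} (hα : 0 < α) {t : ℝ} (ht : 0 ≤ t) (A B : ℝ)
    {ζ : ℝ → ℝ} (hζ : ContinuousOn ζ (Icc 0 t)) :
    ∫ s in (0 : ℝ)..t, (t - s) ^ (α - 1) * (A + B * ζ s)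
      = A * (t ^ α / α) + B * ∫ s in (0 : ℝ)..t, (t - s) ^ (α - 1) * ζ s := by
  have h1 := intervalIntegrable_kernel hα t 0 t
  have h2 : IntervalIntegrable (fun s => (t - s) ^ (α - 1) * ζ s) volume 0 t :=
    h1.mul_continuousOn (by rwa [uIcc_of_le ht])
  have h3 : ∀ s, (t - s) ^ (α - 1) * (A + B * ζ s)
      = A * (t - s) ^ (α - 1) + B * ((t - s) ^ (α - 1) * ζ s) := fun s => by ring
  simp only [h3]
  rw [intervalIntegral.integral_add (h1.const_mul A) (h2.const_mul B),
    intervalIntegral.integral_const_mul, intervalIntegral.integral_const_mul,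
    integral_kernel hα, sub_self, Real.zero_rpow hα.ne', sub_zero, sub_zero]

/-- Homogeneity of the fractional integral: dilating the argument by `l` amounts to dilating the
integrand and multiplying by `l ^ α`. -/
theorem integral_kernel_dilation (α : ℝ) {l t : ℝ} (hl : 0 < l) (ht : 0 ≤ t) (g : ℝ → E) :
    ∫ s in (0 : ℝ)..(l * t), (l * t - s) ^ (α - 1) • g s
      = ∫ s in (0 : ℝ)..t, (t - s) ^ (α - 1) • (l ^ α • g (l * s)) := by
  have h := intervalIntegral.smul_integral_comp_mul_left (a := 0) (b := t)
    (fun s => (l * t - s) ^ (α - 1) • g s) l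
  rw [mul_zero] at h
  rw [← h, ← intervalIntegral.integral_smul]
  refine intervalIntegral.integral_congr fun s hs => ?_
  rw [uIcc_of_le ht] at hs
  rw [← mul_sub, Real.mul_rpow hl.le (sub_nonneg.2 hs.2), smul_smul, smul_smul, ← mul_assoc]
  congr 1
  have : l ^ α = l * l ^ (α - 1) := by
    rw [Real.rpow_sub_one hl.ne', mul_div_cancel₀ _ hl.ne']
  rw [this]
  ring

/-- The data of a Volterra equation `y = P + I^α g` on `[0, T]` with smooth `P`, where `g` is
obtained from `y` by a `C²` superposition operator. Of the latter only its effect on first and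
second differences is recorded. -/
structure IsSmoothVolterra (α T M L : ℝ) (P y g : ℝ → E) : Prop where
  order_pos : 0 < α
  length_pos : 0 < T
  const_nonneg : 0 ≤ M
  lipschitz_nonneg : 0 ≤ L
  contDiff : ContDiff ℝ 2 P
  continuousOn : ContinuousOn y (Icc 0 T)
  continuousOn_rhs : ContinuousOn g (Icc 0 T)
  equation : ∀ t ∈ Icc 0 T,
    y t = P t + (Real.Gamma α)⁻¹ • ∫ s in (0 : ℝ)..t, (t - s) ^ (α - 1) • g s
  firstDiff : ∀ a ∈ Icc 0 T, ∀ b ∈ Icc 0 T, ‖g b - g a‖ ≤ M * (|b - a| + ‖y b - y a‖)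
  secondDiff : ∀ a ∈ Icc 0 T, ∀ b ∈ Icc 0 T, ∀ θ η : ℝ, 0 ≤ θ → 0 ≤ η → θ + η = 1 →
    ‖g (θ * a + η * b) - θ • g a - η • g b‖
      ≤ L * ‖y (θ * a + η * b) - θ • y a - η • y b‖ + M * (|b - a| ^ 2 + ‖y b - y a‖ ^ 2)

namespace IsSmoothVolterra

variable {α T M L : ℝ} {P y g : ℝ → E}

theorem equation_dilation (h : IsSmoothVolterra α T M L P y g) {l : ℝ} (hl : l ∈ Icc (1 / 2) 1)
    {t : ℝ} (ht : t ∈ Icc 0 T) :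
    y (l * t) = P (l * t)
      + (Real.Gamma α)⁻¹ • ∫ s in (0 : ℝ)..t, (t - s) ^ (α - 1) • (l ^ α • g (l * s)) := by
  have hl0 : (0 : ℝ) < l := lt_of_lt_of_le (by norm_num) hl.1
  have hmem : l * t ∈ Icc 0 T :=
    ⟨mul_nonneg hl0.le ht.1, (mul_le_of_le_one_left ht.1 hl.2).trans ht.2⟩
  rw [h.equation _ hmem, integral_kernel_dilation α hl0 ht.1]

theorem dilation_mem {l : ℝ} (hl : l ∈ Icc (1 / 2) 1) {t : ℝ} (ht : t ∈ Icc 0 T) :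
    l * t ∈ Icc 0 T :=
  ⟨mul_nonneg (le_trans (by norm_num) hl.1) ht.1, (mul_le_of_le_one_left ht.1 hl.2).trans ht.2⟩

theorem continuousOn_dilation {F : Type*} [TopologicalSpace F] {φ : ℝ → F} (hφ : ContinuousOn φ (Icc 0 T)) {l : ℝ}
    (hl : l ∈ Icc (1 / 2) 1) : ContinuousOn (fun t => φ (l * t)) (Icc 0 T) :=
  hφ.comp (by fun_prop) fun _ ht => dilation_mem hl ht

theorem intervalIntegrable_dilation (h : IsSmoothVolterra α T M L P y g) {l : ℝ}
    (hl : l ∈ Icc (1 / 2) 1) {t : ℝ} (ht : t ∈ Icc 0 T) :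
    IntervalIntegrable (fun s => (t - s) ^ (α - 1) • (l ^ α • g (l * s))) volume 0 t := by
  refine (intervalIntegrable_kernel h.order_pos t 0 t).smul_continuousOn ?_
  rw [uIcc_of_le ht.1]
  exact ((continuousOn_dilation h.continuousOn_rhs hl).mono (Icc_subset_Icc_right ht.2)).const_smul
    (l ^ α)

/-- Lipschitz dependence of the dilated solution on the dilation factor. -/
theorem exists_dilation_firstDiff_bound (h : IsSmoothVolterra α T M L P y g) {β : ℝ} (hβ : 0 < β)
    (hβα : β ≤ α) (hβ1 : β ≤ 1) :
    ∃ C : ℝ, 0 ≤ C ∧ ∀ l ∈ Icc (1 / 2 : ℝ) 1, ∀ l' ∈ Icc (1 / 2 : ℝ) 1, ∀ t ∈ Icc 0 T,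
      ‖y (l' * t) - y (l * t)‖ ≤ C * |l' - l| * t ^ β := by
  have hα := h.order_pos
  have hΓ := Real.Gamma_pos_of_pos hα
  obtain ⟨C, hC0, hC⟩ := exists_gronwall_bound (α := α) (c := (Real.Gamma α)⁻¹ * M) (T := T) hα
    (mul_nonneg (inv_nonneg.2 hΓ.le) h.const_nonneg)
  obtain ⟨MP, hMP0, hMP⟩ := exists_lipschitz_bound_of_contDiffOn (K := Icc 0 T)
    (h.contDiff.of_le (m := 1) (by norm_num)).contDiffOn uniqueDiffOn_univ isCompact_Icc
    (convex_Icc _ _) (subset_univ _)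
  obtain ⟨Mp, hMp0, hMp⟩ := exists_lipschitz_bound_of_contDiffOn (K := Icc (1 / 2 : ℝ) 1)
    (φ := fun x : ℝ => x ^ α) (S := Ioi 0)
    (contDiffOn_id.rpow_const_of_ne fun x hx => (ne_of_gt hx)) isOpen_Ioi.uniqueDiffOn
    isCompact_Icc (convex_Icc _ _) (fun x hx => lt_of_lt_of_le (by norm_num) hx.1)
  obtain ⟨G, hG⟩ := isCompact_Icc.exists_bound_of_continuousOn h.continuousOn_rhs
  have hG0 : 0 ≤ G := (norm_nonneg _).trans (hG 0 ⟨le_rfl, h.length_pos.le⟩)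
  obtain ⟨C1, hC10, hC1⟩ := exists_rpow_le_rpow T hβ hβ1
  obtain ⟨C2, hC20, hC2⟩ := exists_rpow_le_rpow T hβ hβα
  set A := Mp * G + M * T with hA
  have hM := h.const_nonneg
  have hT := h.length_pos
  have hA0 : 0 ≤ A := by positivity
  refine ⟨C * (MP * C1 + (Real.Gamma α)⁻¹ * A / α * C2), by positivity,
    fun l hl l' hl' t' ht' => ?_⟩
  have hd := abs_nonneg (l' - l)
  have hl'1 : 0 ≤ l' ^ α ∧ l' ^ α ≤ 1 :=
    ⟨Real.rpow_nonneg (le_trans (by norm_num) hl'.1) _,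
      Real.rpow_le_one (le_trans (by norm_num) hl'.1) hl'.2 hα.le⟩
  have hcont : ContinuousOn (fun t => ‖y (l' * t) - y (l * t)‖) (Icc 0 t') :=
    (((continuousOn_dilation h.continuousOn hl').sub
      (continuousOn_dilation h.continuousOn hl)).norm).mono (Icc_subset_Icc_right ht'.2)
  have key : ∀ t ∈ Icc 0 t', ‖y (l' * t) - y (l * t)‖
      ≤ |l' - l| * (MP * t' + (Real.Gamma α)⁻¹ * A * (t' ^ α / α)) + (Real.Gamma α)⁻¹ * M *
        ∫ s in (0 : ℝ)..t, (t - s) ^ (α - 1) * ‖y (l' * s) - y (l * s)‖ := by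
    intro t ht
    have htT : t ∈ Icc 0 T := ⟨ht.1, ht.2.trans ht'.2⟩
    have hw : ∀ s ∈ Icc 0 t, ‖l' ^ α • g (l' * s) - l ^ α • g (l * s)‖
        ≤ |l' - l| * A + M * ‖y (l' * s) - y (l * s)‖ := by
      intro s hs
      have hsT : s ∈ Icc 0 T := ⟨hs.1, hs.2.trans htT.2⟩
      have h1 := h.firstDiff _ (dilation_mem hl hsT) _ (dilation_mem hl' hsT)
      have h2 := hMp l hl l' hl'
      simp only [Real.norm_eq_abs] at h2
      have h3 : |l' * s - l * s| ≤ |l' - l| * T := by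
        rw [← sub_mul, abs_mul, abs_of_nonneg hs.1]
        exact mul_le_mul_of_nonneg_left hsT.2 hd
      have h4 : l' ^ α • g (l' * s) - l ^ α • g (l * s)
          = l' ^ α • (g (l' * s) - g (l * s)) + (l' ^ α - l ^ α) • g (l * s) := by module
      rw [h4]
      refine (norm_add_le _ _).trans ?_
      rw [norm_smul, norm_smul, Real.norm_of_nonneg hl'1.1, Real.norm_eq_abs]
      have h5 : l' ^ α * ‖g (l' * s) - g (l * s)‖
          ≤ M * (|l' - l| * T + ‖y (l' * s) - y (l * s)‖) :=
        (mul_le_of_le_one_left (norm_nonneg _) hl'1.2).trans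
          (h1.trans (mul_le_mul_of_nonneg_left (by linarith) hM))
      have h6 : |l' ^ α - l ^ α| * ‖g (l * s)‖ ≤ Mp * |l' - l| * G :=
        mul_le_mul h2 (hG _ (dilation_mem hl hsT)) (norm_nonneg _) (by positivity)
      rw [hA]
      linarith
    have hct := hcont.mono (Icc_subset_Icc_right ht.2)
    have h1 := norm_integral_kernel_smul_le hα ht.1
      (v := fun s => |l' - l| * A + M * ‖y (l' * s) - y (l * s)‖)
      (continuousOn_const.add (continuousOn_const.mul hct)) hw
    rw [integral_kernel_mul_affine hα ht.1 _ _ hct] at h1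
    have h2 : y (l' * t) - y (l * t) = (P (l' * t) - P (l * t)) + (Real.Gamma α)⁻¹ •
        ∫ s in (0 : ℝ)..t, (t - s) ^ (α - 1) • (l' ^ α • g (l' * s) - l ^ α • g (l * s)) := by
      simp only [smul_sub (_ ^ (α - 1))]
      rw [intervalIntegral.integral_sub (h.intervalIntegrable_dilation hl' htT)
        (h.intervalIntegrable_dilation hl htT), h.equation_dilation hl' htT,
        h.equation_dilation hl htT]
      module
    have h3 : ‖P (l' * t) - P (l * t)‖ ≤ MP * (|l' - l| * t) := by
      refine (hMP _ (dilation_mem hl htT) _ (dilation_mem hl' htT)).trans_eq ?_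
      rw [← sub_mul, Real.norm_eq_abs, abs_mul, abs_of_nonneg ht.1]
    have h4 : t ^ α ≤ t' ^ α := Real.rpow_le_rpow ht.1 ht.2 hα.le
    have h5 := ht.2
    rw [h2]
    refine (norm_add_le _ _).trans ?_
    rw [norm_smul, norm_inv, Real.norm_of_nonneg hΓ.le]
    calc _ ≤ MP * (|l' - l| * t) + (Real.Gamma α)⁻¹ * (|l' - l| * A * (t ^ α / α) +
            M * ∫ s in (0 : ℝ)..t, (t - s) ^ (α - 1) * ‖y (l' * s) - y (l * s)‖) := by gcongr
      _ ≤ MP * (|l' - l| * t') + (Real.Gamma α)⁻¹ * (|l' - l| * A * (t' ^ α / α) +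
            M * ∫ s in (0 : ℝ)..t, (t - s) ^ (α - 1) * ‖y (l' * s) - y (l * s)‖) := by gcongr
      _ = _ := by ring
  have hfin := hC t' ht' _ _ hcont (fun t _ => norm_nonneg _) key
  refine hfin.trans ?_
  have h1 := hC1 t' ht'
  have h2 := hC2 t' ht'
  rw [Real.rpow_one] at h1
  calc C * (|l' - l| * (MP * t' + (Real.Gamma α)⁻¹ * A * (t' ^ α / α)))
      ≤ C * (|l' - l| * (MP * (C1 * t' ^ β) + (Real.Gamma α)⁻¹ * A * (C2 * t' ^ β / α))) := by
        gcongr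
    _ = _ := by ring

end IsSmoothVolterra

end Scaling

/-! ### Second-order regularity of the right-hand side -/

section SecondOrderRegularity

variable {E : Type*} [NormedAddCommGroup E] [NormedSpace ℝ E]

namespace IsSmoothVolterra

variable {α T M L : ℝ} {P y g : ℝ → E}

/-- The dilated solution `y (l * t)` has second differences of size `O(t ^ γ)` with respect to
the dilation factor `l`. The exponent `γ ≤ α` is forced by the factor `l ^ α` in front of the
fractional integral; it is not needed for `α = 1`, where this factor is affine. -/
theorem exists_dilation_secondDiff_bound (h : IsSmoothVolterra α T M L P y g) {β γ : ℝ}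
    (hβ : 0 < β) (hβα : β ≤ α) (hβ1 : β ≤ 1) (hγ : 0 < γ) (hγ2 : γ ≤ 2) (hγα : γ ≤ α + β)
    (hγα' : α ≠ 1 → γ ≤ α) :
    ∃ C : ℝ, 0 ≤ C ∧ ∀ l ∈ Icc (1 / 2 : ℝ) 1, ∀ l' ∈ Icc (1 / 2 : ℝ) 1, ∀ θ η : ℝ, 0 ≤ θ →
      0 ≤ η → θ + η = 1 → ∀ t ∈ Icc 0 T,
      ‖y ((θ * l + η * l') * t) - θ • y (l * t) - η • y (l' * t)‖
        ≤ C * |l' - l| ^ 2 * t ^ γ := by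
  have hα := h.order_pos
  have hΓ := Real.Gamma_pos_of_pos hα
  have hM := h.const_nonneg
  have hL := h.lipschitz_nonneg
  have hT := h.length_pos
  obtain ⟨C, hC0, hC⟩ := exists_gronwall_bound (α := α) (c := (Real.Gamma α)⁻¹ * L) (T := T) hα
    (mul_nonneg (inv_nonneg.2 hΓ.le) hL)
  obtain ⟨MP, hMP0, hMP⟩ := exists_secondDiff_bound_of_contDiffOn (K := Icc 0 T)
    h.contDiff.contDiffOn uniqueDiffOn_univ isCompact_Icc (convex_Icc _ _) (subset_univ _)
  obtain ⟨Mp, hMp0, hMp⟩ := exists_lipschitz_bound_of_contDiffOn (K := Icc (1 / 2 : ℝ) 1)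
    (φ := fun x : ℝ => x ^ α) (S := Ioi 0)
    (contDiffOn_id.rpow_const_of_ne fun x hx => (ne_of_gt hx)) isOpen_Ioi.uniqueDiffOn
    isCompact_Icc (convex_Icc _ _) (fun x hx => lt_of_lt_of_le (by norm_num) hx.1)
  -- the second difference of `l ^ α`, which vanishes for `α = 1`
  obtain ⟨cp, hcp0, hcp, hcp1⟩ : ∃ cp : ℝ, 0 ≤ cp ∧ (∀ x ∈ Icc (1 / 2 : ℝ) 1,
      ∀ z ∈ Icc (1 / 2 : ℝ) 1, ∀ θ η : ℝ, 0 ≤ θ → 0 ≤ η → θ + η = 1 →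
      |(θ * x + η * z) ^ α - θ * x ^ α - η * z ^ α| ≤ cp * |z - x| ^ 2) ∧ (α = 1 → cp = 0) := by
    by_cases h1 : α = 1
    · refine ⟨0, le_rfl, fun x _ z _ θ η _ _ _ => ?_, fun _ => rfl⟩
      rw [h1, Real.rpow_one, Real.rpow_one, Real.rpow_one]
      ring_nf
      simp
    · obtain ⟨cp, h0, h2⟩ := exists_secondDiff_bound_of_contDiffOn (K := Icc (1 / 2 : ℝ) 1)
        (φ := fun x : ℝ => x ^ α) (S := Ioi 0)
        (contDiffOn_id.rpow_const_of_ne fun x hx => (ne_of_gt hx)) isOpen_Ioi.uniqueDiffOn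
        isCompact_Icc (convex_Icc _ _) (fun x hx => lt_of_lt_of_le (by norm_num) hx.1)
      exact ⟨cp, h0, by simpa only [smul_eq_mul, Real.norm_eq_abs] using h2, fun h => absurd h h1⟩
  obtain ⟨G, hG⟩ := isCompact_Icc.exists_bound_of_continuousOn h.continuousOn_rhs
  have hG0 : 0 ≤ G := (norm_nonneg _).trans (hG 0 ⟨le_rfl, hT.le⟩)
  obtain ⟨C1, hC10, hC1⟩ := h.exists_dilation_firstDiff_bound hβ hβα hβ1
  obtain ⟨C2, hC20, hC2⟩ := exists_rpow_le_rpow T hβ hβ1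
  obtain ⟨C3, hC30, hC3⟩ := exists_rpow_le_rpow T hγ hγ2
  obtain ⟨C4, hC40, hC4⟩ := exists_rpow_le_rpow T hγ hγα
  obtain ⟨C5, hC50, hC5⟩ : ∃ C5 : ℝ, 0 ≤ C5 ∧ ∀ t ∈ Icc 0 T, cp * t ^ α ≤ C5 * t ^ γ := by
    by_cases h1 : α = 1
    · refine ⟨0, le_rfl, fun t _ => ?_⟩
      rw [hcp1 h1]
      simp
    · obtain ⟨C5, h0, h2⟩ := exists_rpow_le_rpow T hγ (hγα' h1)
      refine ⟨cp * C5, by positivity, fun t ht => ?_⟩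
      rw [mul_assoc]
      exact mul_le_mul_of_nonneg_left (h2 t ht) hcp0
  set D := C2 + C1 with hD
  have hD0 : 0 ≤ D := by positivity
  have hTβ : 0 ≤ T ^ β := Real.rpow_nonneg hT.le _
  set H := M * D ^ 2 * T ^ β + Mp * (M * D) with hH
  have hH0 : 0 ≤ H := by positivity
  refine ⟨C * (MP * C3 + (Real.Gamma α)⁻¹ / α * (C5 * G + H * C4)), by positivity,
    fun l hl l' hl' θ η hθ hη hsum t' ht' => ?_⟩
  set δ := |l' - l| with hδ
  have hδ0 : 0 ≤ δ := abs_nonneg _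
  set m := θ * l + η * l' with hm
  have hmI : m ∈ Icc (1 / 2 : ℝ) 1 := convex_Icc _ _ hl hl' hθ hη hsum
  have hlm : |l - m| ≤ δ := by
    have : l - m = -(η * (l' - l)) := by
      rw [hm]
      linear_combination (-l) * hsum
    rw [this, abs_neg, abs_mul, abs_of_nonneg hη]
    exact mul_le_of_le_one_left hδ0 (by linarith)
  have hl'm : |l' - m| ≤ δ := by
    have : l' - m = θ * (l' - l) := by
      rw [hm]
      linear_combination (-l') * hsum
    rw [this, abs_mul, abs_of_nonneg hθ]
    exact mul_le_of_le_one_left hδ0 (by linarith)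
  have hm1 : 0 ≤ m ^ α ∧ m ^ α ≤ 1 :=
    ⟨Real.rpow_nonneg (le_trans (by norm_num) hmI.1) _,
      Real.rpow_le_one (le_trans (by norm_num) hmI.1) hmI.2 hα.le⟩
  have ht'β : 0 ≤ t' ^ β := Real.rpow_nonneg ht'.1 _
  have hcont : ContinuousOn (fun t => ‖y (m * t) - θ • y (l * t) - η • y (l' * t)‖)
      (Icc 0 t') :=
    ((((continuousOn_dilation h.continuousOn hmI).sub
      ((continuousOn_dilation h.continuousOn hl).const_smul θ)).sub
      ((continuousOn_dilation h.continuousOn hl').const_smul η)).norm).mono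
      (Icc_subset_Icc_right ht'.2)
  -- first differences of the dilated right-hand side
  have hgd : ∀ k ∈ Icc (1 / 2 : ℝ) 1, |k - m| ≤ δ → ∀ s ∈ Icc 0 t',
      ‖g (k * s) - g (m * s)‖ ≤ M * D * t' ^ β * δ := by
    intro k hk hkm s hs
    have hsT : s ∈ Icc 0 T := ⟨hs.1, hs.2.trans ht'.2⟩
    have h1 := h.firstDiff _ (dilation_mem hmI hsT) _ (dilation_mem hk hsT)
    have h2 := hC1 m hmI k hk s hsT
    have h3 := hC2 s hsT
    rw [Real.rpow_one] at h3
    have h4 : s ^ β ≤ t' ^ β := Real.rpow_le_rpow hs.1 hs.2 hβ.le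
    have h5 : |k * s - m * s| ≤ δ * (C2 * t' ^ β) := by
      rw [← sub_mul, abs_mul, abs_of_nonneg hs.1]
      exact mul_le_mul hkm (h3.trans (mul_le_mul_of_nonneg_left h4 hC20)) hs.1 hδ0
    have h6 : C1 * |k - m| * s ^ β ≤ C1 * δ * t' ^ β := by
      have := Real.rpow_nonneg hs.1 β
      gcongr
    calc _ ≤ M * (δ * (C2 * t' ^ β) + C1 * δ * t' ^ β) :=
          h1.trans (mul_le_mul_of_nonneg_left (add_le_add h5 (h2.trans h6)) hM)
      _ = _ := by rw [hD]; ring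
  have key : ∀ t ∈ Icc 0 t', ‖y (m * t) - θ • y (l * t) - η • y (l' * t)‖
      ≤ δ ^ 2 * (MP * t' ^ 2 + (Real.Gamma α)⁻¹ * ((cp * G + H * t' ^ β) * (t' ^ α / α)))
        + (Real.Gamma α)⁻¹ * L * ∫ s in (0 : ℝ)..t, (t - s) ^ (α - 1) *
          ‖y (m * s) - θ • y (l * s) - η • y (l' * s)‖ := by
    intro t ht
    have htT : t ∈ Icc 0 T := ⟨ht.1, ht.2.trans ht'.2⟩
    have hw : ∀ s ∈ Icc 0 t,
        ‖m ^ α • g (m * s) - θ • l ^ α • g (l * s) - η • l' ^ α • g (l' * s)‖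
        ≤ δ ^ 2 * (cp * G + H * t' ^ β)
          + L * ‖y (m * s) - θ • y (l * s) - η • y (l' * s)‖ := by
      intro s hs
      have hst' : s ∈ Icc 0 t' := ⟨hs.1, hs.2.trans ht.2⟩
      have hsT : s ∈ Icc 0 T := ⟨hs.1, hs.2.trans htT.2⟩
      have hms : m * s = θ * (l * s) + η * (l' * s) := by
        rw [hm]
        ring
      have h1 := h.secondDiff _ (dilation_mem hl hsT) _ (dilation_mem hl' hsT) θ η hθ hη hsum
      rw [← hms] at h1
      have h2 := hcp l hl l' hl' θ η hθ hη hsum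
      rw [← hm, ← hδ] at h2
      -- the product rule for second differences
      have hsplit : m ^ α • g (m * s) - θ • l ^ α • g (l * s) - η • l' ^ α • g (l' * s)
          = m ^ α • (g (m * s) - θ • g (l * s) - η • g (l' * s))
            + (m ^ α - θ * l ^ α - η * l' ^ α) • g (m * s)
            + (θ * (m ^ α - l ^ α)) • (g (l * s) - g (m * s))
            + (η * (m ^ α - l' ^ α)) • (g (l' * s) - g (m * s)) := by
        have hη' : η = 1 - θ := by linarith
        rw [hη']
        module
      have e1 : ‖m ^ α • (g (m * s) - θ • g (l * s) - η • g (l' * s))‖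
          ≤ L * ‖y (m * s) - θ • y (l * s) - η • y (l' * s)‖
            + δ ^ 2 * (M * D ^ 2 * T ^ β * t' ^ β) := by
        rw [norm_smul, Real.norm_of_nonneg hm1.1]
        refine (mul_le_of_le_one_left (norm_nonneg _) hm1.2).trans (h1.trans ?_)
        have h3 := hC1 l hl l' hl' s hsT
        have h4 := hC2 s hsT
        rw [Real.rpow_one] at h4
        have h5 : s ^ β ≤ t' ^ β := Real.rpow_le_rpow hs.1 hst'.2 hβ.le
        have h6 : t' ^ β ≤ T ^ β := Real.rpow_le_rpow ht'.1 ht'.2 hβ.le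
        have h7 : |l' * s - l * s| ≤ δ * (C2 * t' ^ β) := by
          rw [← sub_mul, abs_mul, abs_of_nonneg hs.1]
          exact mul_le_mul_of_nonneg_left (h4.trans (mul_le_mul_of_nonneg_left h5 hC20)) hδ0
        have h8 : ‖y (l' * s) - y (l * s)‖ ≤ δ * (C1 * t' ^ β) := by
          refine h3.trans ?_
          rw [mul_comm C1, mul_assoc]
          gcongr
        have h9 : |l' * s - l * s| ^ 2 + ‖y (l' * s) - y (l * s)‖ ^ 2
            ≤ (δ * (D * t' ^ β)) ^ 2 := by
          calc _ ≤ (δ * (C2 * t' ^ β)) ^ 2 + (δ * (C1 * t' ^ β)) ^ 2 :=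
                add_le_add (pow_le_pow_left₀ (abs_nonneg _) h7 2)
                  (pow_le_pow_left₀ (norm_nonneg _) h8 2)
            _ ≤ (δ * (C2 * t' ^ β) + δ * (C1 * t' ^ β)) ^ 2 := by
                have : 0 ≤ (δ * (C2 * t' ^ β)) * (δ * (C1 * t' ^ β)) := by positivity
                linarith [add_sq (δ * (C2 * t' ^ β)) (δ * (C1 * t' ^ β))]
            _ = _ := by rw [hD]; ring
        have h10 : (δ * (D * t' ^ β)) ^ 2 ≤ δ ^ 2 * (D ^ 2 * T ^ β * t' ^ β) := by
          calc (δ * (D * t' ^ β)) ^ 2 = δ ^ 2 * (D ^ 2 * t' ^ β * t' ^ β) := by ring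
            _ ≤ _ := by gcongr
        have := mul_le_mul_of_nonneg_left (h9.trans h10) hM
        linarith
      have e2 : ‖(m ^ α - θ * l ^ α - η * l' ^ α) • g (m * s)‖ ≤ δ ^ 2 * (cp * G) := by
        rw [norm_smul, Real.norm_eq_abs]
        calc _ ≤ cp * δ ^ 2 * G := mul_le_mul h2 (hG _ (dilation_mem hmI hsT)) (norm_nonneg _)
              (by positivity)
          _ = _ := by ring
      have e3 : ∀ k ∈ Icc (1 / 2 : ℝ) 1, |k - m| ≤ δ → ∀ ν : ℝ, 0 ≤ ν →
          ‖(ν * (m ^ α - k ^ α)) • (g (k * s) - g (m * s))‖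
            ≤ ν * (δ ^ 2 * (Mp * (M * D) * t' ^ β)) := by
        intro k hk hkm ν hν
        have h3 := hMp k hk m hmI
        simp only [Real.norm_eq_abs] at h3
        rw [abs_sub_comm m k] at h3
        rw [norm_smul, norm_mul, Real.norm_of_nonneg hν, Real.norm_eq_abs, mul_assoc]
        refine mul_le_mul_of_nonneg_left ?_ hν
        calc _ ≤ (Mp * δ) * (M * D * t' ^ β * δ) :=
              mul_le_mul (h3.trans (mul_le_mul_of_nonneg_left hkm hMp0)) (hgd k hk hkm s hst')
                (norm_nonneg _) (by positivity)
          _ = _ := by ring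
      have e4 := e3 l hl hlm θ hθ
      have e5 := e3 l' hl' hl'm η hη
      have e6 : θ * (δ ^ 2 * (Mp * (M * D) * t' ^ β)) + η * (δ ^ 2 * (Mp * (M * D) * t' ^ β))
          = δ ^ 2 * (Mp * (M * D) * t' ^ β) := by rw [← add_mul, hsum, one_mul]
      rw [hsplit]
      refine (norm_add_le _ _).trans ?_
      have n1 := norm_add₃_le (a := m ^ α • (g (m * s) - θ • g (l * s) - η • g (l' * s)))
        (b := (m ^ α - θ * l ^ α - η * l' ^ α) • g (m * s))
        (c := (θ * (m ^ α - l ^ α)) • (g (l * s) - g (m * s)))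
      rw [hH]
      linarith
    have hct := hcont.mono (Icc_subset_Icc_right ht.2)
    have h1 := norm_integral_kernel_smul_le hα ht.1
      (v := fun s => δ ^ 2 * (cp * G + H * t' ^ β)
        + L * ‖y (m * s) - θ • y (l * s) - η • y (l' * s)‖)
      (continuousOn_const.add (continuousOn_const.mul hct)) hw
    rw [integral_kernel_mul_affine hα ht.1 _ _ hct] at h1
    have h2 : y (m * t) - θ • y (l * t) - η • y (l' * t)
        = (P (m * t) - θ • P (l * t) - η • P (l' * t)) + (Real.Gamma α)⁻¹ •
        ∫ s in (0 : ℝ)..t, (t - s) ^ (α - 1) •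
          (m ^ α • g (m * s) - θ • l ^ α • g (l * s) - η • l' ^ α • g (l' * s)) := by
      have hi := h.intervalIntegrable_dilation hl htT
      have hi' := h.intervalIntegrable_dilation hl' htT
      have him := h.intervalIntegrable_dilation hmI htT
      have hiθ : IntervalIntegrable (fun s => θ • (t - s) ^ (α - 1) • l ^ α • g (l * s))
        volume 0 t := hi.smul θ
      have hiη : IntervalIntegrable (fun s => η • (t - s) ^ (α - 1) • l' ^ α • g (l' * s))
        volume 0 t := hi'.smul η
      simp only [smul_sub (_ ^ (α - 1)), smul_comm ((t - _) ^ (α - 1)) θ,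
        smul_comm ((t - _) ^ (α - 1)) η]
      rw [intervalIntegral.integral_sub (him.sub hiθ) hiη,
        intervalIntegral.integral_sub him hiθ, intervalIntegral.integral_smul,
        intervalIntegral.integral_smul, h.equation_dilation hl' htT,
        h.equation_dilation hl htT, h.equation_dilation hmI htT]
      module
    have h3 : ‖P (m * t) - θ • P (l * t) - η • P (l' * t)‖ ≤ MP * (δ ^ 2 * t ^ 2) := by
      have := hMP _ (dilation_mem hl htT) _ (dilation_mem hl' htT) θ η hθ hη hsum
      have hmt : m * t = θ * (l * t) + η * (l' * t) := by
        rw [hm]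
        ring
      rw [smul_eq_mul, smul_eq_mul, ← hmt] at this
      refine this.trans_eq ?_
      rw [← sub_mul, Real.norm_eq_abs, abs_mul, abs_of_nonneg ht.1, mul_pow]
    have h4 : t ^ α ≤ t' ^ α := Real.rpow_le_rpow ht.1 ht.2 hα.le
    have h5 : t ^ 2 ≤ t' ^ 2 := pow_le_pow_left₀ ht.1 ht.2 2
    rw [h2]
    refine (norm_add_le _ _).trans ?_
    rw [norm_smul, norm_inv, Real.norm_of_nonneg hΓ.le]
    set J := ∫ s in (0 : ℝ)..t, (t - s) ^ (α - 1) *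
          ‖y (m * s) - θ • y (l * s) - η • y (l' * s)‖
    calc _ ≤ MP * (δ ^ 2 * t ^ 2) + (Real.Gamma α)⁻¹ *
            (δ ^ 2 * (cp * G + H * t' ^ β) * (t ^ α / α) + L * J) := by gcongr
      _ ≤ MP * (δ ^ 2 * t' ^ 2) + (Real.Gamma α)⁻¹ *
            (δ ^ 2 * (cp * G + H * t' ^ β) * (t' ^ α / α) + L * J) := by gcongr
      _ = _ := by ring
  have hfin := hC t' ht' _ _ hcont (fun t _ => norm_nonneg _) key
  refine hfin.trans ?_
  have h1 : t' ^ 2 ≤ C3 * t' ^ γ := by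
    have := hC3 t' ht'
    rwa [Real.rpow_two] at this
  have h2 : t' ^ α * t' ^ β ≤ C4 * t' ^ γ := by
    have := hC4 t' ht'
    rwa [Real.rpow_add_of_nonneg ht'.1 hα.le hβ.le] at this
  have h3 := hC5 t' ht'
  calc C * (δ ^ 2 * (MP * t' ^ 2 + (Real.Gamma α)⁻¹ * ((cp * G + H * t' ^ β) * (t' ^ α / α))))
      = C * (δ ^ 2 * (MP * t' ^ 2 + (Real.Gamma α)⁻¹ / α *
          (cp * t' ^ α * G + H * (t' ^ α * t' ^ β)))) := by ring
    _ ≤ C * (δ ^ 2 * (MP * (C3 * t' ^ γ) + (Real.Gamma α)⁻¹ / α *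
          (C5 * t' ^ γ * G + H * (C4 * t' ^ γ)))) := by gcongr
    _ = _ := by ring

/-- Away from the left end point, the right-hand side behaves under second differences as if its
second derivative were `O(s ^ (γ - 2))`. -/
theorem exists_rhs_secondDiff_bound (h : IsSmoothVolterra α T M L P y g) {β γ : ℝ}
    (hβ : 0 < β) (hβα : β ≤ α) (hβ1 : β ≤ 1) (hγ : 0 < γ) (hγβ : γ ≤ 2 * β)
    (hγα' : α ≠ 1 → γ ≤ α) :
    ∃ C : ℝ, 0 ≤ C ∧ ∀ a b : ℝ, 0 < a → a ≤ b → b ≤ 2 * a → b ≤ T → ∀ θ η : ℝ, 0 ≤ θ → 0 ≤ η →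
      θ + η = 1 →
      ‖g (θ * a + η * b) - θ • g a - η • g b‖ ≤ C * (b - a) ^ 2 * b ^ (γ - 2) := by
  have hM := h.const_nonneg
  have hL := h.lipschitz_nonneg
  obtain ⟨C1, hC10, hC1⟩ := h.exists_dilation_firstDiff_bound hβ hβα hβ1
  obtain ⟨C2, hC20, hC2⟩ := h.exists_dilation_secondDiff_bound hβ hβα hβ1 hγ (by linarith)
    (by linarith) hγα'
  obtain ⟨C3, hC30, hC3⟩ := exists_rpow_le_rpow (p := 2) T hγ (by linarith)
  obtain ⟨C4, hC40, hC4⟩ := exists_rpow_le_rpow (p := 2 * β) T hγ hγβ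
  refine ⟨L * C2 + M * (C3 + C1 ^ 2 * C4), by positivity,
    fun a b ha hab hba hbT θ η hθ hη hsum => ?_⟩
  have hb : 0 < b := ha.trans_le hab
  have hbI : b ∈ Icc 0 T := ⟨hb.le, hbT⟩
  have hl : a / b ∈ Icc (1 / 2 : ℝ) 1 :=
    ⟨by rw [le_div_iff₀ hb]; linarith, (div_le_one hb).2 hab⟩
  have hl1 : (1 : ℝ) ∈ Icc (1 / 2 : ℝ) 1 := ⟨by norm_num, le_rfl⟩
  have h1 := hC1 _ hl 1 hl1 b hbI
  have h2 := hC2 _ hl 1 hl1 θ η hθ hη hsum b hbI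
  have hg := h.secondDiff a ⟨ha.le, hab.trans hbT⟩ b hbI θ η hθ hη hsum
  have ea : a / b * b = a := div_mul_cancel₀ a hb.ne'
  have em : (θ * (a / b) + η * 1) * b = θ * a + η * b := by field_simp
  rw [ea, one_mul] at h1 h2
  rw [em] at h2
  have hδ : |1 - a / b| = (b - a) / b := by
    rw [abs_of_nonneg (sub_nonneg.2 hl.2)]
    field_simp
  rw [hδ] at h1 h2
  set q := (b - a) / b with hq
  have hq0 : 0 ≤ q := div_nonneg (sub_nonneg.2 hab) hb.le
  have hbγ : b ^ (γ - 2) = b ^ γ / b ^ 2 := by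
    rw [Real.rpow_sub hb, Real.rpow_two]
  have h3 : b ^ 2 ≤ C3 * b ^ γ := by
    have := hC3 b hbI
    rwa [Real.rpow_two] at this
  have h4 : (b ^ β) ^ 2 ≤ C4 * b ^ γ := by
    have := hC4 b hbI
    rwa [mul_comm 2 β, Real.rpow_mul hb.le, Real.rpow_two] at this
  have h5 : |b - a| ^ 2 ≤ q ^ 2 * (C3 * b ^ γ) := by
    have : |b - a| ^ 2 = q ^ 2 * b ^ 2 := by
      rw [sq_abs, hq]
      field_simp
    rw [this]
    gcongr
  have h6 : ‖y b - y a‖ ^ 2 ≤ q ^ 2 * (C1 ^ 2 * (C4 * b ^ γ)) := by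
    calc ‖y b - y a‖ ^ 2 ≤ (C1 * q * b ^ β) ^ 2 := pow_le_pow_left₀ (norm_nonneg _) h1 2
      _ = q ^ 2 * (C1 ^ 2 * (b ^ β) ^ 2) := by ring
      _ ≤ _ := by gcongr
  refine hg.trans ?_
  calc _ ≤ L * (C2 * q ^ 2 * b ^ γ)
        + M * (q ^ 2 * (C3 * b ^ γ) + q ^ 2 * (C1 ^ 2 * (C4 * b ^ γ))) := by gcongr
    _ = (L * C2 + M * (C3 + C1 ^ 2 * C4)) * (q ^ 2 * b ^ γ) := by ring
    _ = _ := by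
      rw [hbγ, hq]
      field_simp

/-- Near the left end point, the right-hand side is Hölder continuous of order `min(α, 1)`. -/
theorem exists_rhs_holder_bound (h : IsSmoothVolterra α T M L P y g) {β : ℝ}
    (hβ : 0 < β) (hβα : β ≤ α) (hβ1 : β ≤ 1) :
    ∃ C : ℝ, 0 ≤ C ∧ ∀ s ∈ Icc 0 T, ‖g s - g 0‖ ≤ C * s ^ β := by
  have hα := h.order_pos
  have hΓ := Real.Gamma_pos_of_pos hα
  have hM := h.const_nonneg
  have hT := h.length_pos
  obtain ⟨MP, hMP0, hMP⟩ := exists_lipschitz_bound_of_contDiffOn (K := Icc 0 T)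
    (h.contDiff.of_le (m := 1) (by norm_num)).contDiffOn uniqueDiffOn_univ isCompact_Icc
    (convex_Icc _ _) (subset_univ _)
  obtain ⟨G, hG⟩ := isCompact_Icc.exists_bound_of_continuousOn h.continuousOn_rhs
  have h0T : (0 : ℝ) ∈ Icc 0 T := ⟨le_rfl, hT.le⟩
  have hG0 : 0 ≤ G := (norm_nonneg _).trans (hG 0 h0T)
  obtain ⟨C1, hC10, hC1⟩ := exists_rpow_le_rpow T hβ hβ1
  obtain ⟨C2, hC20, hC2⟩ := exists_rpow_le_rpow T hβ hβα
  refine ⟨M * (C1 + (MP * C1 + (Real.Gamma α)⁻¹ * (G * (C2 / α)))), by positivity,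
    fun s hs => ?_⟩
  have h1 := hC1 s hs
  have h2 := hC2 s hs
  rw [Real.rpow_one] at h1
  have hint : ‖∫ r in (0 : ℝ)..s, (s - r) ^ (α - 1) • g r‖ ≤ G * (s ^ α / α) := by
    refine (norm_integral_kernel_smul_le hα hs.1 (v := fun _ => G) continuousOn_const
      fun r hr => hG r ⟨hr.1, hr.2.trans hs.2⟩).trans_eq ?_
    rw [intervalIntegral.integral_mul_const, integral_kernel hα, sub_self,
      Real.zero_rpow hα.ne', sub_zero, sub_zero, mul_comm]
  have hy : y s - y 0 = (P s - P 0)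
      + (Real.Gamma α)⁻¹ • ∫ r in (0 : ℝ)..s, (s - r) ^ (α - 1) • g r := by
    rw [h.equation s hs, h.equation 0 h0T, intervalIntegral.integral_same, smul_zero]
    abel
  have hP := hMP 0 h0T s hs
  rw [sub_zero, Real.norm_of_nonneg hs.1] at hP
  have hy' : ‖y s - y 0‖ ≤ MP * s + (Real.Gamma α)⁻¹ * (G * (s ^ α / α)) := by
    rw [hy]
    refine (norm_add_le _ _).trans ?_
    rw [norm_smul, norm_inv, Real.norm_of_nonneg hΓ.le]
    gcongr
  have hg := h.firstDiff 0 h0T s hs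
  rw [sub_zero, abs_of_nonneg hs.1] at hg
  calc _ ≤ M * (s + (MP * s + (Real.Gamma α)⁻¹ * (G * (s ^ α / α)))) :=
        hg.trans (mul_le_mul_of_nonneg_left (by linarith) hM)
    _ ≤ M * (C1 * s ^ β + (MP * (C1 * s ^ β)
          + (Real.Gamma α)⁻¹ * (G * (C2 * s ^ β / α)))) := by gcongr
    _ = _ := by ring

end IsSmoothVolterra

end SecondOrderRegularity

/-! ### The error profile under fractional integration -/

section KernelEstimates

/-- The error profile: with `β = min(α, 1)`, the numerical error at distance `s` from the initial
point is bounded by a multiple of `(s + h)^(β - 1) h^(1 + β) + h²`. The shift by `h` makes the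
profile comparable to its values at neighbouring grid points. -/
noncomputable def errorProfile (α h s : ℝ) : ℝ :=
  (s + h) ^ (min α 1 - 1) * h ^ (1 + min α 1) + h ^ 2

theorem errorProfile_pos (α : ℝ) {h s : ℝ} (hh : 0 < h) (hs : 0 ≤ s) : 0 < errorProfile α h s := by
  unfold errorProfile
  positivity

theorem sq_le_errorProfile (α : ℝ) {h s : ℝ} (hh : 0 < h) (hs : 0 ≤ s) :
    h ^ 2 ≤ errorProfile α h s := by
  unfold errorProfile
  have : 0 ≤ (s + h) ^ (min α 1 - 1) * h ^ (1 + min α 1) := by positivity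
  linarith

theorem errorProfile_anti (α : ℝ) {h s s' : ℝ} (hh : 0 < h) (hs : 0 ≤ s) (hss' : s ≤ s') :
    errorProfile α h s' ≤ errorProfile α h s := by
  unfold errorProfile
  have : (s' + h) ^ (min α 1 - 1) ≤ (s + h) ^ (min α 1 - 1) :=
    Real.rpow_le_rpow_of_nonpos (by linarith) (by linarith) (by linarith [min_le_right α 1])
  gcongr

theorem errorProfile_le_two_mul {α : ℝ} (hα : 0 < α) {h s s' : ℝ} (hh : 0 < h) (hs : 0 ≤ s)
    (hs' : s' ≤ s + h) (hs'0 : 0 ≤ s') : errorProfile α h s ≤ 2 * errorProfile α h s' := by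
  unfold errorProfile
  have hβ : min α 1 - 1 ≤ 0 := by linarith [min_le_right α 1]
  have hβ0 : 0 < min α 1 := lt_min hα one_pos
  have h1 : (s + h) ^ (min α 1 - 1) ≤ ((s' + h) / 2) ^ (min α 1 - 1) :=
    Real.rpow_le_rpow_of_nonpos (by linarith) (by linarith) hβ
  have h2 : ((s' + h) / 2) ^ (min α 1 - 1) ≤ 2 * (s' + h) ^ (min α 1 - 1) := by
    rw [div_eq_mul_inv, Real.mul_rpow (by linarith) (by norm_num), mul_comm]
    refine mul_le_mul_of_nonneg_right ?_ (Real.rpow_nonneg (by linarith) _)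
    rw [Real.inv_rpow (by norm_num), ← Real.rpow_neg (by norm_num)]
    calc (2 : ℝ) ^ (-(min α 1 - 1)) ≤ 2 ^ (1 : ℝ) :=
          Real.rpow_le_rpow_of_exponent_le (by norm_num) (by linarith)
      _ = 2 := Real.rpow_one 2
  have h3 : 0 ≤ h ^ (1 + min α 1) := by positivity
  nlinarith [mul_le_mul_of_nonneg_right (h1.trans h2) h3, sq_nonneg h]

theorem intervalIntegrable_kernel_mul_rpow {α : ℝ} (hα : 0 < α) {h a b : ℝ} (hh : 0 < h)
    (ha : 0 ≤ a) (hab : a ≤ b) (x q : ℝ) :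
    IntervalIntegrable (fun s => (x - s) ^ (α - 1) * (s + h) ^ q) volume a b := by
  refine (intervalIntegrable_kernel hα x a b).mul_continuousOn ?_
  rw [uIcc_of_le hab]
  exact ContinuousOn.rpow_const (by fun_prop) fun s hs => Or.inl (by linarith [hs.1])

theorem integral_add_rpow {h a b : ℝ} (hh : 0 < h) (ha : 0 ≤ a) (hab : a ≤ b) {q : ℝ}
    (hq : q + 1 ≠ 0) :
    ∫ s in a..b, (s + h) ^ q = ((b + h) ^ (q + 1) - (a + h) ^ (q + 1)) / (q + 1) := by
  rw [intervalIntegral.integral_comp_add_right (fun u => u ^ q) h, integral_rpow]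
  refine Or.inr ⟨fun h0 => hq (by rw [h0]; norm_num), ?_⟩
  rw [uIcc_of_le (by linarith)]
  exact fun h0 => by linarith [h0.1]

/-- In the product of two decreasing powers of `x - s` and of `s + h` on `[p, x]`, one of the two
bases is always at least half of its maximal value. -/
theorem kernel_mul_rpow_le {α q : ℝ} (hα1 : α ≤ 1) (hq : q ≤ 0) {h p x s : ℝ} (hh : 0 < h)
    (hp : 0 ≤ p) (hps : p ≤ s) (hsx : s ≤ x) (hpx : p < x) :
    (x - s) ^ (α - 1) * (s + h) ^ q
      ≤ ((x - p) / 2) ^ (α - 1) * (s + h) ^ q + (x - s) ^ (α - 1) * ((x + h) / 2) ^ q := by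
  have h1 : 0 ≤ (x - s) ^ (α - 1) := Real.rpow_nonneg (by linarith) _
  have h2 : 0 ≤ (s + h) ^ q := Real.rpow_nonneg (by linarith) _
  have h3 : 0 ≤ ((x - p) / 2) ^ (α - 1) := Real.rpow_nonneg (by linarith) _
  have h4 : 0 ≤ ((x + h) / 2) ^ q := Real.rpow_nonneg (by linarith) _
  rcases le_total (2 * s) (x + p) with h5 | h5
  · have : (x - s) ^ (α - 1) ≤ ((x - p) / 2) ^ (α - 1) :=
      Real.rpow_le_rpow_of_nonpos (by linarith) (by linarith) (by linarith)
    nlinarith [mul_le_mul_of_nonneg_right this h2, mul_nonneg h1 h4]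
  · have : (s + h) ^ q ≤ ((x + h) / 2) ^ q :=
      Real.rpow_le_rpow_of_nonpos (by linarith) (by linarith) hq
    nlinarith [mul_le_mul_of_nonneg_left this h1, mul_nonneg h3 h2]

theorem integral_kernel_mul_rpow_le {α q : ℝ} (hα : 0 < α) (hα1 : α ≤ 1) (hq : q ≤ 0) {h p x : ℝ}
    (hh : 0 < h) (hp : 0 ≤ p) (hpx : p < x) :
    ∫ s in p..x, (x - s) ^ (α - 1) * (s + h) ^ q
      ≤ ((x - p) / 2) ^ (α - 1) * (∫ s in p..x, (s + h) ^ q)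
        + (x - p) ^ α / α * ((x + h) / 2) ^ q := by
  have hk := intervalIntegrable_kernel hα x p x
  have hq' : IntervalIntegrable (fun s => (s + h) ^ q) volume p x := by
    refine ContinuousOn.intervalIntegrable ?_
    rw [uIcc_of_le hpx.le]
    exact ContinuousOn.rpow_const (by fun_prop) fun s hs => Or.inl (by linarith [hs.1])
  have h1 := intervalIntegral.integral_mono_on hpx.le
    (intervalIntegrable_kernel_mul_rpow hα hh hp hpx.le x q)
    ((hq'.const_mul (((x - p) / 2) ^ (α - 1))).add (hk.mul_const (((x + h) / 2) ^ q)))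
    (fun s hs => kernel_mul_rpow_le hα1 hq hh hp hs.1 hs.2 hpx)
  refine h1.trans_eq ?_
  rw [intervalIntegral.integral_add (hq'.const_mul _) (hk.mul_const _),
    intervalIntegral.integral_const_mul, intervalIntegral.integral_mul_const, integral_kernel hα,
    sub_self, Real.zero_rpow hα.ne', sub_zero]

/-- The fractional integral of order `α` of the error profile over a short interval `[p, x]` is
small compared to the profile at the right end point. -/
theorem exists_integral_kernel_errorProfile_le {α : ℝ} (hα : 0 < α) :
    ∃ K : ℝ, 0 ≤ K ∧ ∀ h p x : ℝ, 0 < h → 0 ≤ p → p ≤ x →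
      ∫ s in p..x, (x - s) ^ (α - 1) * errorProfile α h s
        ≤ K * (x - p) ^ α * errorProfile α h x := by
  -- the singular part of the profile
  obtain ⟨K, hK0, hK⟩ : ∃ K : ℝ, 0 ≤ K ∧ ∀ h p x : ℝ, 0 < h → 0 ≤ p → p ≤ x →
      ∫ s in p..x, (x - s) ^ (α - 1) * (s + h) ^ (min α 1 - 1)
        ≤ K * (x - p) ^ α * (x + h) ^ (min α 1 - 1) := by
    rcases le_or_gt 1 α with h1 | h1
    · refine ⟨1 / α, by positivity, fun h p x hh hp hpx => ?_⟩
      rw [min_eq_right h1]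
      simp only [sub_self, Real.rpow_zero, mul_one]
      rw [integral_kernel hα, sub_self, Real.zero_rpow hα.ne', sub_zero]
      exact le_of_eq (by ring)
    · refine ⟨4 / α, by positivity, fun h p x hh hp hpx => ?_⟩
      rw [min_eq_left h1.le]
      rcases hpx.eq_or_lt with rfl | hlt
      · rw [intervalIntegral.integral_same, sub_self, Real.zero_rpow hα.ne']
        simp
      refine (integral_kernel_mul_rpow_le hα h1.le (by linarith) hh hp hlt).trans ?_
      have hd : 0 < x - p := sub_pos.2 hlt
      have hx : 0 < x + h := by linarith
      have e1 : ∫ s in p..x, (s + h) ^ (α - 1) ≤ (x - p) * (x + h) ^ (α - 1) / α := by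
        rw [integral_add_rpow hh hp hpx (by linarith), sub_add_cancel]
        refine div_le_div_of_nonneg_right ?_ hα.le
        have e2 : ∀ u : ℝ, 0 < u → u ^ α = u ^ (α - 1) * u := fun u hu => by
          rw [Real.rpow_sub_one hu.ne', div_mul_cancel₀ _ hu.ne']
        rw [e2 _ hx, e2 (p + h) (by linarith)]
        have e3 : (x + h) ^ (α - 1) ≤ (p + h) ^ (α - 1) :=
          Real.rpow_le_rpow_of_nonpos (by linarith) (by linarith) (by linarith)
        nlinarith [mul_le_mul_of_nonneg_right e3 (by linarith : 0 ≤ p + h)]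
      have e4 : ∀ u : ℝ, 0 < u → (u / 2) ^ (α - 1) ≤ 2 * u ^ (α - 1) := fun u hu => by
        rw [div_eq_mul_inv, Real.mul_rpow hu.le (by norm_num), mul_comm]
        refine mul_le_mul_of_nonneg_right ?_ (Real.rpow_nonneg hu.le _)
        rw [Real.inv_rpow (by norm_num), ← Real.rpow_neg (by norm_num)]
        calc (2 : ℝ) ^ (-(α - 1)) ≤ 2 ^ (1 : ℝ) :=
              Real.rpow_le_rpow_of_exponent_le (by norm_num) (by linarith)
          _ = 2 := Real.rpow_one 2
      have e5 : (x - p) ^ α = (x - p) ^ (α - 1) * (x - p) := by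
        rw [Real.rpow_sub_one hd.ne', div_mul_cancel₀ _ hd.ne']
      have e6 := e4 _ hd
      have e7 := e4 _ hx
      have n1 : 0 ≤ (x - p) ^ (α - 1) := by positivity
      have n2 : 0 ≤ (x + h) ^ (α - 1) := by positivity
      have n3 : 0 ≤ ∫ s in p..x, (s + h) ^ (α - 1) :=
        intervalIntegral.integral_nonneg hpx fun s hs => Real.rpow_nonneg (by linarith [hs.1]) _
      calc _ ≤ (2 * (x - p) ^ (α - 1)) * ((x - p) * (x + h) ^ (α - 1) / α)
            + (x - p) ^ α / α * (2 * (x + h) ^ (α - 1)) := by gcongr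
        _ = 4 / α * (x - p) ^ α * (x + h) ^ (α - 1) := by
          rw [e5]
          ring
  refine ⟨max K (1 / α), hK0.trans (le_max_left _ _), fun h p x hh hp hpx => ?_⟩
  have hk := intervalIntegrable_kernel hα x p x
  have hI := intervalIntegrable_kernel_mul_rpow hα hh hp hpx x (min α 1 - 1)
  have hsplit : ∀ s, (x - s) ^ (α - 1) * errorProfile α h s
      = (x - s) ^ (α - 1) * (s + h) ^ (min α 1 - 1) * h ^ (1 + min α 1)
        + (x - s) ^ (α - 1) * h ^ 2 := fun s => by
    unfold errorProfile
    ring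
  simp only [hsplit]
  rw [intervalIntegral.integral_add (hI.mul_const _) (hk.mul_const _),
    intervalIntegral.integral_mul_const, intervalIntegral.integral_mul_const, integral_kernel hα,
    sub_self, Real.zero_rpow hα.ne', sub_zero]
  have h1 := hK h p x hh hp hpx
  have hd : 0 ≤ (x - p) ^ α := Real.rpow_nonneg (by linarith) _
  have hx : 0 ≤ (x + h) ^ (min α 1 - 1) := Real.rpow_nonneg (by linarith) _
  have h2 : K ≤ max K (1 / α) := le_max_left _ _
  have h3 : 1 / α ≤ max K (1 / α) := le_max_right _ _
  calc _ ≤ (max K (1 / α) * (x - p) ^ α * (x + h) ^ (min α 1 - 1)) * h ^ (1 + min α 1)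
        + (max K (1 / α) * (x - p) ^ α) * h ^ 2 := by
        refine add_le_add (mul_le_mul_of_nonneg_right (h1.trans ?_) (by positivity))
          (mul_le_mul_of_nonneg_right ?_ (by positivity))
        · gcongr
        · rw [div_eq_mul_one_div, mul_comm]
          gcongr
    _ = _ := by
      unfold errorProfile
      ring

/-- The local interpolation errors, in terms of the step bound `h` and of the exponents of the
regularity estimates for the right-hand side. -/
noncomputable def interpolationProfile (β γ h s : ℝ) : ℝ :=
  h ^ 2 * (s + h) ^ (γ - 2) + h ^ (2 + β) * (s + h) ^ (-2 : ℝ)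

/-- The integrated interpolation error is dominated by the error profile. -/
theorem exists_integral_kernel_interpolationProfile_le {α γ T : ℝ} (hα : 0 < α) (hT : 0 < T)
    (hγ1 : α < 1 → γ = α) (hγ2 : 1 ≤ α → 1 < γ) :
    ∃ K : ℝ, 0 ≤ K ∧ ∀ h ∈ Ioc 0 T, ∀ x ∈ Icc 0 T,
      ∫ s in (0 : ℝ)..x, (x - s) ^ (α - 1) * interpolationProfile (min α 1) γ h s
        ≤ K * errorProfile α h x := by
  rcases le_or_gt 1 α with h1 | h1
  · have hγ := hγ2 h1
    have hTα : 0 ≤ T ^ (α - 1) := Real.rpow_nonneg hT.le _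
    refine ⟨T ^ (α - 1) * ((2 * T) ^ (γ - 1) / (γ - 1) + 1), ?_, fun h hh x hx => ?_⟩
    · have : 0 ≤ γ - 1 := by linarith
      positivity
    have hh0 := hh.1
    rw [min_eq_right h1]
    have hc : ∀ q : ℝ, IntervalIntegrable (fun s => (s + h) ^ q) volume 0 x := fun q => by
      refine ContinuousOn.intervalIntegrable ?_
      rw [uIcc_of_le hx.1]
      exact ContinuousOn.rpow_const (by fun_prop) fun s hs => Or.inl (by linarith [hs.1])
    have hmono : ∫ s in (0 : ℝ)..x, (x - s) ^ (α - 1) * interpolationProfile 1 γ h s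
        ≤ ∫ s in (0 : ℝ)..x, T ^ (α - 1) * (h ^ 2 * (s + h) ^ (γ - 2)
          + h ^ ((2 : ℝ) + 1) * (s + h) ^ (-2 : ℝ)) := by
      refine intervalIntegral.integral_mono_on hx.1 ?_ ?_ fun s hs => ?_
      · refine (intervalIntegrable_kernel hα x 0 x).mul_continuousOn ?_
        rw [uIcc_of_le hx.1]
        unfold interpolationProfile
        refine ContinuousOn.add (continuousOn_const.mul ?_) (continuousOn_const.mul ?_)
        all_goals
          exact ContinuousOn.rpow_const (by fun_prop) fun s hs => Or.inl (by linarith [hs.1])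
      · exact (((hc _).const_mul _).add ((hc _).const_mul _)).const_mul _
      · have hsh : 0 < s + h := by linarith [hs.1]
        unfold interpolationProfile
        refine mul_le_mul_of_nonneg_right ?_ (by positivity)
        exact Real.rpow_le_rpow (by linarith [hs.2]) (by linarith [hs.1, hx.2]) (by linarith)
    refine hmono.trans ?_
    rw [intervalIntegral.integral_const_mul, intervalIntegral.integral_add ((hc _).const_mul _)
      ((hc _).const_mul _), intervalIntegral.integral_const_mul,
      intervalIntegral.integral_const_mul, integral_add_rpow hh0 le_rfl hx.1 (by linarith),
      integral_add_rpow hh0 le_rfl hx.1 (by norm_num), zero_add]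
    have e1 : ((x + h) ^ (γ - 2 + 1) - h ^ (γ - 2 + 1)) / (γ - 2 + 1)
        ≤ (2 * T) ^ (γ - 1) / (γ - 1) := by
      rw [show γ - 2 + 1 = γ - 1 by ring]
      refine div_le_div_of_nonneg_right ?_ (by linarith)
      have : (x + h) ^ (γ - 1) ≤ (2 * T) ^ (γ - 1) :=
        Real.rpow_le_rpow (by linarith [hx.1]) (by linarith [hx.2, hh.2]) (by linarith)
      have : 0 ≤ h ^ (γ - 1) := by positivity
      linarith
    have e2 : h ^ ((2 : ℝ) + 1) * (((x + h) ^ ((-2 : ℝ) + 1) - h ^ ((-2 : ℝ) + 1)) / (-2 + 1))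
        ≤ h ^ 2 := by
      have e3 : h ^ ((2 : ℝ) + 1) * h ^ ((-2 : ℝ) + 1) = h ^ 2 := by
        rw [← Real.rpow_add hh0, ← Real.rpow_two]
        norm_num
      have e4 : 0 ≤ (x + h) ^ ((-2 : ℝ) + 1) := Real.rpow_nonneg (by linarith [hx.1]) _
      have e5 : 0 ≤ h ^ ((2 : ℝ) + 1) := by positivity
      calc _ = h ^ ((2 : ℝ) + 1) * h ^ ((-2 : ℝ) + 1)
            - h ^ ((2 : ℝ) + 1) * (x + h) ^ ((-2 : ℝ) + 1) := by ring
        _ ≤ _ := by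
          rw [e3]
          linarith [mul_nonneg e5 e4]
    have e6 := sq_le_errorProfile α hh0 hx.1
    have e7 : 0 ≤ (2 * T) ^ (γ - 1) / (γ - 1) := by
      have : 0 ≤ γ - 1 := by linarith
      positivity
    calc _ ≤ T ^ (α - 1) * (h ^ 2 * ((2 * T) ^ (γ - 1) / (γ - 1)) + h ^ 2) := by gcongr
      _ = T ^ (α - 1) * ((2 * T) ^ (γ - 1) / (γ - 1) + 1) * h ^ 2 := by ring
      _ ≤ _ := mul_le_mul_of_nonneg_left e6 (by positivity)
  · have hγ := hγ1 h1
    subst hγ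
    have h1α : 0 < 1 - γ := by linarith
    refine ⟨2 * (4 / (1 - γ) + 4 / γ), by positivity, fun h hh x hx => ?_⟩
    have hh0 := hh.1
    rw [min_eq_left h1.le]
    have hxh : 0 < x + h := by linarith [hx.1]
    -- the two parts of the profile are comparable to the first one
    have hle : ∫ s in (0 : ℝ)..x, (x - s) ^ (γ - 1) * interpolationProfile γ γ h s
        ≤ ∫ s in (0 : ℝ)..x, (2 * h ^ 2) * ((x - s) ^ (γ - 1) * (s + h) ^ (γ - 2)) := by
      refine intervalIntegral.integral_mono_on hx.1 ?_ ?_ fun s hs => ?_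
      · refine (intervalIntegrable_kernel hα x 0 x).mul_continuousOn ?_
        rw [uIcc_of_le hx.1]
        unfold interpolationProfile
        refine ContinuousOn.add (continuousOn_const.mul ?_) (continuousOn_const.mul ?_)
        all_goals
          exact ContinuousOn.rpow_const (by fun_prop) fun s hs => Or.inl (by linarith [hs.1])
      · exact (intervalIntegrable_kernel_mul_rpow hα hh0 le_rfl hx.1 x _).const_mul _
      · have hsh : 0 < s + h := by linarith [hs.1]
        have hk : 0 ≤ (x - s) ^ (γ - 1) := Real.rpow_nonneg (by linarith [hs.2]) _
        have e1 : h ^ (2 + γ) * (s + h) ^ (-2 : ℝ) ≤ h ^ 2 * (s + h) ^ (γ - 2) := by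
          rw [Real.rpow_add hh0, Real.rpow_two, mul_assoc,
            show γ - 2 = γ + (-2) by ring, Real.rpow_add hsh]
          have : h ^ γ ≤ (s + h) ^ γ := Real.rpow_le_rpow hh0.le (by linarith [hs.1]) hα.le
          gcongr
        unfold interpolationProfile
        calc _ ≤ (x - s) ^ (γ - 1) * (h ^ 2 * (s + h) ^ (γ - 2) + h ^ 2 * (s + h) ^ (γ - 2)) := by
              gcongr
          _ = _ := by ring
    have hmain : ∫ s in (0 : ℝ)..x, (x - s) ^ (γ - 1) * (s + h) ^ (γ - 2)
        ≤ (4 / (1 - γ) + 4 / γ) * ((x + h) ^ (γ - 1) * h ^ (γ - 1)) := by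
      have hn : 0 ≤ (x + h) ^ (γ - 1) * h ^ (γ - 1) := by positivity
      have e2 : ∀ u c q : ℝ, 0 < u → 0 < c → (u / c) ^ q = c ^ (-q) * u ^ q := fun u c q hu hc => by
        rw [Real.div_rpow hu.le hc.le, Real.rpow_neg hc.le]
        ring
      rcases le_total x h with hxh' | hxh'
      · -- here the factor `(s + h)^(γ - 2)` is essentially constant
        have f1 : ∫ s in (0 : ℝ)..x, (x - s) ^ (γ - 1) * (s + h) ^ (γ - 2)
            ≤ ∫ s in (0 : ℝ)..x, (x - s) ^ (γ - 1) * h ^ (γ - 2) := by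
          refine intervalIntegral.integral_mono_on hx.1
            (intervalIntegrable_kernel_mul_rpow hα hh0 le_rfl hx.1 x _)
            ((intervalIntegrable_kernel hα x 0 x).mul_const _) fun s hs => ?_
          refine mul_le_mul_of_nonneg_left ?_ (Real.rpow_nonneg (by linarith [hs.2]) _)
          exact Real.rpow_le_rpow_of_nonpos hh0 (by linarith [hs.1]) (by linarith)
        rw [intervalIntegral.integral_mul_const, integral_kernel hα, sub_self,
          Real.zero_rpow hα.ne', sub_zero, sub_zero] at f1
        have f2 : x ^ γ ≤ h ^ γ := Real.rpow_le_rpow hx.1 hxh' hα.le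
        have f3 : h ^ γ * h ^ (γ - 2) = h ^ (γ - 1) * h ^ (γ - 1) := by
          rw [← Real.rpow_add hh0, ← Real.rpow_add hh0]
          ring_nf
        have f4 : h ^ (γ - 1) ≤ 2 * (x + h) ^ (γ - 1) := by
          calc h ^ (γ - 1) ≤ ((x + h) / 2) ^ (γ - 1) :=
                Real.rpow_le_rpow_of_nonpos (by linarith) (by linarith) (by linarith)
            _ = 2 ^ (-(γ - 1)) * (x + h) ^ (γ - 1) := e2 _ _ _ hxh two_pos
            _ ≤ 2 ^ (1 : ℝ) * (x + h) ^ (γ - 1) := by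
                gcongr
                · norm_num
                · linarith
            _ = _ := by rw [Real.rpow_one]
        calc _ ≤ h ^ γ / γ * h ^ (γ - 2) := f1.trans (by gcongr)
          _ = (h ^ γ * h ^ (γ - 2)) / γ := by ring
          _ = h ^ (γ - 1) * h ^ (γ - 1) / γ := by rw [f3]
          _ ≤ (2 * (x + h) ^ (γ - 1)) * h ^ (γ - 1) / γ := by gcongr
          _ = 2 / γ * ((x + h) ^ (γ - 1) * h ^ (γ - 1)) := by ring
          _ ≤ _ := by
            refine mul_le_mul_of_nonneg_right ?_ hn
            have : 2 / γ ≤ 4 / γ := by gcongr; norm_num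
            have : 0 ≤ 4 / (1 - γ) := by positivity
            linarith
      · have hx0 : 0 < x := hh0.trans_le hxh'
        refine (integral_kernel_mul_rpow_le hα h1.le (by linarith) hh0 le_rfl hx0).trans ?_
        rw [sub_zero]
        have f1 : ∫ s in (0 : ℝ)..x, (s + h) ^ (γ - 2) ≤ h ^ (γ - 1) / (1 - γ) := by
          rw [integral_add_rpow hh0 le_rfl hx.1 (by linarith), zero_add,
            show γ - 2 + 1 = -(1 - γ) by ring, div_neg, ← neg_div]
          refine div_le_div_of_nonneg_right ?_ h1α.le
          have : 0 ≤ (x + h) ^ (-(1 - γ)) := by positivity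
          rw [show γ - 1 = -(1 - γ) by ring]
          linarith
        have f0 : 0 ≤ ∫ s in (0 : ℝ)..x, (s + h) ^ (γ - 2) :=
          intervalIntegral.integral_nonneg hx.1 fun s hs => Real.rpow_nonneg (by linarith [hs.1]) _
        have f2 : (x / 2) ^ (γ - 1) ≤ 4 * (x + h) ^ (γ - 1) := by
          calc (x / 2) ^ (γ - 1) ≤ ((x + h) / 4) ^ (γ - 1) :=
                Real.rpow_le_rpow_of_nonpos (by linarith) (by linarith) (by linarith)
            _ = 4 ^ (-(γ - 1)) * (x + h) ^ (γ - 1) := e2 _ _ _ hxh (by norm_num)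
            _ ≤ 4 ^ (1 : ℝ) * (x + h) ^ (γ - 1) := by
                gcongr
                · norm_num
                · linarith
            _ = _ := by rw [Real.rpow_one]
        have f3 : x ^ γ * ((x + h) / 2) ^ (γ - 2) ≤ 4 * ((x + h) ^ (γ - 1) * h ^ (γ - 1)) := by
          have g1 : x ^ γ ≤ (x + h) ^ γ := Real.rpow_le_rpow hx.1 (by linarith) hα.le
          have g2 : (x + h) ^ γ * (x + h) ^ (γ - 2) = (x + h) ^ (γ - 1) * (x + h) ^ (γ - 1) := by
            rw [← Real.rpow_add hxh, ← Real.rpow_add hxh]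
            ring_nf
          have g3 : (x + h) ^ (γ - 1) ≤ h ^ (γ - 1) :=
            Real.rpow_le_rpow_of_nonpos hh0 (by linarith) (by linarith)
          have g4 : (2 : ℝ) ^ (-(γ - 2)) ≤ 4 := by
            calc (2 : ℝ) ^ (-(γ - 2)) ≤ 2 ^ (2 : ℝ) :=
                  Real.rpow_le_rpow_of_exponent_le (by norm_num) (by linarith)
              _ = 4 := by norm_num
          rw [e2 _ _ _ hxh two_pos]
          calc _ ≤ (x + h) ^ γ * (4 * (x + h) ^ (γ - 2)) := by gcongr
            _ = 4 * ((x + h) ^ (γ - 1) * (x + h) ^ (γ - 1)) := by rw [← g2]; ring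
            _ ≤ _ := by gcongr
        calc _ ≤ (4 * (x + h) ^ (γ - 1)) * (h ^ (γ - 1) / (1 - γ))
              + x ^ γ * ((x + h) / 2) ^ (γ - 2) / γ := by
                refine add_le_add ?_ (le_of_eq (by ring))
                gcongr
          _ ≤ (4 * (x + h) ^ (γ - 1)) * (h ^ (γ - 1) / (1 - γ))
              + 4 * ((x + h) ^ (γ - 1) * h ^ (γ - 1)) / γ := by gcongr
          _ = _ := by ring
    rw [intervalIntegral.integral_const_mul] at hle
    refine hle.trans ?_
    have hfin : h ^ 2 * h ^ (γ - 1) = h ^ (1 + γ) := by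
      rw [← Real.rpow_two, ← Real.rpow_add hh0]
      ring_nf
    calc _ ≤ 2 * h ^ 2 * ((4 / (1 - γ) + 4 / γ) * ((x + h) ^ (γ - 1) * h ^ (γ - 1))) := by gcongr
      _ = 2 * (4 / (1 - γ) + 4 / γ) * ((x + h) ^ (γ - 1) * (h ^ 2 * h ^ (γ - 1))) := by ring
      _ ≤ _ := by
        rw [hfin]
        unfold errorProfile
        rw [min_eq_left h1.le]
        have : 0 ≤ h ^ 2 := by positivity
        gcongr
        linarith

end KernelEstimates

/-! ### The quadrature weights -/

section Weights

/-- The integral of the normalised kernel of order `α` at `x` over a grid interval `[a, b]`,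
weighted with the part `(b - s) / (b - a)` of the hat function of the left end point. -/
noncomputable def hatLeft (α x a b : ℝ) : ℝ :=
  (Real.Gamma α)⁻¹ * ∫ s in a..b, (x - s) ^ (α - 1) * ((b - s) / (b - a))

/-- The integral of the normalised kernel of order `α` at `x` over a grid interval `[a, b]`,
weighted with the part `(s - a) / (b - a)` of the hat function of the right end point. -/
noncomputable def hatRight (α x a b : ℝ) : ℝ :=
  (Real.Gamma α)⁻¹ * ∫ s in a..b, (x - s) ^ (α - 1) * ((s - a) / (b - a))

theorem hatLeft_nonneg {α : ℝ} (hα : 0 < α) {x a b : ℝ} (hab : a < b) (hbx : b ≤ x) :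
    0 ≤ hatLeft α x a b := by
  refine mul_nonneg (inv_nonneg.2 (Real.Gamma_pos_of_pos hα).le)
    (intervalIntegral.integral_nonneg hab.le fun s hs => ?_)
  exact mul_nonneg (Real.rpow_nonneg (by linarith [hs.2]) _)
    (div_nonneg (by linarith [hs.2]) (by linarith))

theorem hatRight_nonneg {α : ℝ} (hα : 0 < α) {x a b : ℝ} (hab : a < b) (hbx : b ≤ x) :
    0 ≤ hatRight α x a b := by
  refine mul_nonneg (inv_nonneg.2 (Real.Gamma_pos_of_pos hα).le)
    (intervalIntegral.integral_nonneg hab.le fun s hs => ?_)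
  exact mul_nonneg (Real.rpow_nonneg (by linarith [hs.2]) _)
    (div_nonneg (by linarith [hs.1]) (by linarith))

theorem intervalIntegrable_kernel_hat {α : ℝ} (hα : 0 < α) (x a b p q : ℝ) :
    IntervalIntegrable (fun s => (x - s) ^ (α - 1) * ((p - s) / q)) volume a b ∧
    IntervalIntegrable (fun s => (x - s) ^ (α - 1) * ((s - p) / q)) volume a b :=
  ⟨(intervalIntegrable_kernel hα x a b).mul_continuousOn (by fun_prop),
    (intervalIntegrable_kernel hα x a b).mul_continuousOn (by fun_prop)⟩

theorem hatRight_eq {α : ℝ} (hα : 0 < α) {x a b : ℝ} (hab : a < b) (hbx : b ≤ x) :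
    hatRight α x a b
      = ((x - a) ^ (α + 1) / Real.Gamma (α + 2) - (x - b) ^ (α + 1) / Real.Gamma (α + 2)) / (b - a)
        - (x - b) ^ α / Real.Gamma (α + 1) := by
  have hxa : 0 < x - a := by linarith
  have hxb : 0 ≤ x - b := by linarith
  have hd : b - a ≠ 0 := by linarith
  have h1 : ∫ s in a..b, (x - s) ^ (α - 1) * ((s - a) / (b - a))
      = ∫ s in a..b, ((x - a) / (b - a) * (x - s) ^ (α - 1)
        - (1 / (b - a)) * (x - s) ^ (α + 1 - 1)) := by
    refine intervalIntegral.integral_congr fun s hs => ?_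
    rw [uIcc_of_le hab.le] at hs
    have hxs : 0 ≤ x - s := by linarith [hs.2]
    have h2 : (x - s) ^ (α + 1 - 1) = (x - s) ^ (α - 1) * (x - s) := by
      rw [← Real.rpow_add_one' hxs (by linarith)]
      ring_nf
    simp only [h2]
    field_simp
    ring
  have e1 : (x - a) ^ (α + 1) = (x - a) ^ α * (x - a) :=
    Real.rpow_add_one' hxa.le (by linarith)
  have e2 : (x - b) ^ (α + 1) = (x - b) ^ α * (x - b) :=
    Real.rpow_add_one' hxb (by linarith)
  have hG1 : Real.Gamma (α + 1) = α * Real.Gamma α := Real.Gamma_add_one hα.ne'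
  have hG2 : Real.Gamma (α + 2) = (α + 1) * (α * Real.Gamma α) := by
    rw [show α + 2 = α + 1 + 1 by ring, Real.Gamma_add_one (by linarith), hG1]
  have hG := (Real.Gamma_pos_of_pos hα).ne'
  have hα1 : α + 1 ≠ 0 := by linarith
  rw [hatRight, h1, intervalIntegral.integral_sub ((intervalIntegrable_kernel hα x a b).const_mul _)
    ((intervalIntegrable_kernel (by linarith) x a b).const_mul _),
    intervalIntegral.integral_const_mul, intervalIntegral.integral_const_mul, integral_kernel hα,
    integral_kernel (by linarith), e1, e2, hG1, hG2]
  have hα0 := hα.ne'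
  field_simp
  ring

theorem hatLeft_add_hatRight {α : ℝ} (hα : 0 < α) {x a b : ℝ} (hab : a < b) :
    hatLeft α x a b + hatRight α x a b
      = (x - a) ^ α / Real.Gamma (α + 1) - (x - b) ^ α / Real.Gamma (α + 1) := by
  have hd : b - a ≠ 0 := by linarith
  rw [hatLeft, hatRight, ← mul_add, ← intervalIntegral.integral_add
    (intervalIntegrable_kernel_hat hα x a b b (b - a)).1
    (intervalIntegrable_kernel_hat hα x a b a (b - a)).2]
  have : ∀ s, (x - s) ^ (α - 1) * ((b - s) / (b - a)) + (x - s) ^ (α - 1) * ((s - a) / (b - a))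
      = (x - s) ^ (α - 1) := fun s => by
    field_simp
    ring
  simp only [this]
  rw [integral_kernel hα, Real.Gamma_add_one hα.ne']
  have hG := (Real.Gamma_pos_of_pos hα).ne'
  have hα0 := hα.ne'
  field_simp

theorem hatLeft_eq {α : ℝ} (hα : 0 < α) {x a b : ℝ} (hab : a < b) (hbx : b ≤ x) :
    hatLeft α x a b = (x - a) ^ α / Real.Gamma (α + 1)
      - ((x - a) ^ (α + 1) / Real.Gamma (α + 2) - (x - b) ^ (α + 1) / Real.Gamma (α + 2))
        / (b - a) := by
  have h1 := hatLeft_add_hatRight hα (x := x) hab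
  rw [hatRight_eq hα hab hbx] at h1
  linarith

theorem moment_zero (α : ℝ) (t : ℕ → ℝ) (n j : ℕ) :
    moment α t 0 n j = (t n - t j) ^ α / Real.Gamma (α + 1) := by
  simp [moment]

theorem moment_one (α : ℝ) (t : ℕ → ℝ) (n j : ℕ) :
    moment α t 1 n j = (t n - t j) ^ (α + 1) / Real.Gamma (α + 2) := by
  simp only [moment, Nat.cast_one]
  rw [show α + 1 + 1 = α + 2 by ring]

variable {E : Type*} [NormedAddCommGroup E] [NormedSpace ℝ E]

/-- The product-integration trapezoidal rule, sorted by grid intervals: the sum of the weighted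
nodal values is the fractional integral of the piecewise linear interpolant. -/
theorem sum_weight_eq_sum_hat {α : ℝ} (hα : 0 < α) {t : ℕ → ℝ} {n : ℕ} (hn : 1 ≤ n)
    (ht : ∀ j < n, t j < t (j + 1)) (φ : ℕ → E) :
    weightZero α t n • φ 0 + ∑ j ∈ Finset.Icc 1 n, weight α t n j • φ j
      = ∑ j ∈ Finset.range n, (hatLeft α (t n) (t j) (t (j + 1)) • φ j
        + hatRight α (t n) (t j) (t (j + 1)) • φ (j + 1)) := by
  have hle : ∀ k, k ≤ n → t k ≤ t n := by
    intro k hk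
    induction n, hk using Nat.le_induction with
    | base => exact le_rfl
    | succ n hkn ih =>
      rcases Nat.eq_zero_or_pos n with rfl | hn'
      · obtain rfl : k = 0 := by omega
        exact (ht 0 (by omega)).le
      · exact (ih hn' fun j hj => ht j (by omega)).trans (ht n (by omega)).le
  obtain ⟨k, rfl⟩ : ∃ k, n = k + 1 := ⟨n - 1, by omega⟩
  have hw0 : weightZero α t (k + 1) = hatLeft α (t (k + 1)) (t 0) (t 1) := by
    rw [hatLeft_eq hα (ht 0 (by omega)) (hle 1 (by omega)), weightZero, moment_zero, moment_one,
      moment_one, step]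
    ring
  have hwn : weight α t (k + 1) (k + 1) = hatRight α (t (k + 1)) (t k) (t (k + 1)) := by
    rw [hatRight_eq hα (ht k (by omega)) le_rfl, weight, if_pos rfl, Nat.add_sub_cancel, moment_one,
      step, sub_self, Real.zero_rpow hα.ne', Real.zero_rpow (by linarith)]
    ring
  have hwj : ∀ j < k, weight α t (k + 1) (j + 1)
      = hatLeft α (t (k + 1)) (t (j + 1)) (t (j + 1 + 1))
        + hatRight α (t (k + 1)) (t j) (t (j + 1)) := by
    intro j hj
    rw [hatRight_eq hα (ht j (by omega)) (hle _ (by omega)),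
      hatLeft_eq hα (ht (j + 1) (by omega)) (hle _ (by omega)), weight, if_neg (by omega),
      Nat.add_sub_cancel, moment_one, moment_one, moment_one, step, step]
    ring
  rw [Finset.sum_add_distrib, Finset.sum_range_succ', Finset.sum_range_succ _ k,
    ← Finset.Ico_succ_right_eq_Icc, Finset.sum_Ico_eq_sum_range]
  simp only [Nat.succ_eq_succ, Nat.succ_eq_add_one, Nat.add_sub_cancel, add_comm 1]
  rw [Finset.sum_range_succ, hwn, Finset.sum_congr rfl fun j hj => by
    rw [hwj j (Finset.mem_range.1 hj), add_smul], Finset.sum_add_distrib, hw0]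
  simp only [zero_add]
  abel

end Weights

/-! ### Interpolation and quadrature errors on a grid interval -/

section LocalError

variable {E : Type*} [NormedAddCommGroup E] [NormedSpace ℝ E]

/-- The pointwise error of linear interpolation on a grid interval. Within distance `2 * h` of the
initial point only Hölder continuity is available; farther away the interval is short compared to
its distance from the initial point, and the second-difference bound applies. -/
theorem exists_interpolation_error_bound {T β γ C₁ C₂ : ℝ} {g : ℝ → E} (hβ : 0 < β) (hγ : γ ≤ 2)
    (hC₁ : 0 ≤ C₁) (hC₂ : 0 ≤ C₂) (h₁ : ∀ s ∈ Icc 0 T, ‖g s - g 0‖ ≤ C₁ * s ^ β)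
    (h₂ : ∀ a b : ℝ, 0 < a → a ≤ b → b ≤ 2 * a → b ≤ T → ∀ θ η : ℝ, 0 ≤ θ → 0 ≤ η → θ + η = 1 →
      ‖g (θ * a + η * b) - θ • g a - η • g b‖ ≤ C₂ * (b - a) ^ 2 * b ^ (γ - 2)) :
    ∃ C : ℝ, 0 ≤ C ∧ ∀ h a b s : ℝ, 0 < h → 0 ≤ a → a < b → b ≤ T → b - a ≤ h → s ∈ Icc a b →
      ‖g s - ((b - s) / (b - a)) • g a - ((s - a) / (b - a)) • g b‖
        ≤ C * interpolationProfile β γ h s := by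
  refine ⟨2 * C₁ * 3 ^ (2 + β) + C₂ * (2 / 3) ^ (γ - 2), by positivity,
    fun h a b s hh ha hab hbT hbah hs => ?_⟩
  have hba : 0 < b - a := sub_pos.2 hab
  set θ := (b - s) / (b - a) with hθ
  set η := (s - a) / (b - a) with hη
  have hθ0 : 0 ≤ θ := div_nonneg (by linarith [hs.2]) hba.le
  have hη0 : 0 ≤ η := div_nonneg (by linarith [hs.1]) hba.le
  have hsum : θ + η = 1 := by
    rw [hθ, hη]
    field_simp
    ring
  have hcomb : θ * a + η * b = s := by
    rw [hθ, hη]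
    field_simp
    ring
  have hs0 : 0 ≤ s := ha.trans hs.1
  have hsh : 0 < s + h := by linarith
  have p1 : 0 ≤ h ^ 2 * (s + h) ^ (γ - 2) := by positivity
  have p2 : 0 ≤ h ^ (2 + β) * (s + h) ^ (-2 : ℝ) := by positivity
  unfold interpolationProfile
  have p3 : 0 ≤ 2 * C₁ * 3 ^ (2 + β) := by positivity
  have p4 : 0 ≤ C₂ * (2 / 3) ^ (γ - 2) := by positivity
  rcases le_or_gt s (2 * h) with hs2 | hs2
  · have hb0 : 0 ≤ b := ha.trans hab.le
    have e1 : ∀ r ∈ Icc 0 b, ‖g r - g 0‖ ≤ C₁ * b ^ β := fun r hr =>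
      (h₁ r ⟨hr.1, hr.2.trans hbT⟩).trans
        (mul_le_mul_of_nonneg_left (Real.rpow_le_rpow hr.1 hr.2 hβ.le) hC₁)
    have e2 : g s - θ • g a - η • g b
        = (g s - g 0) - θ • (g a - g 0) - η • (g b - g 0) := by
      have : η = 1 - θ := by linarith
      rw [this]
      module
    have e3 : ‖g s - θ • g a - η • g b‖ ≤ 2 * C₁ * b ^ β := by
      rw [e2]
      refine (norm_sub_le _ _).trans ((add_le_add_left (norm_sub_le _ _) _).trans ?_)
      rw [norm_smul, norm_smul, Real.norm_of_nonneg hθ0, Real.norm_of_nonneg hη0]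
      have f1 := e1 s ⟨hs0, hs.2⟩
      have f2 := mul_le_mul_of_nonneg_left (e1 a ⟨ha, hab.le⟩) hθ0
      have f3 := mul_le_mul_of_nonneg_left (e1 b ⟨hb0, le_rfl⟩) hη0
      have f4 : θ * (C₁ * b ^ β) + η * (C₁ * b ^ β) = C₁ * b ^ β := by
        rw [← add_mul, hsum, one_mul]
      linarith
    have e4 : b ^ β ≤ 3 ^ (2 + β) * (h ^ (2 + β) * (s + h) ^ (-2 : ℝ)) := by
      calc b ^ β ≤ (s + h) ^ β := Real.rpow_le_rpow hb0 (by linarith [hs.1]) hβ.le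
        _ = (s + h) ^ (2 + β) * (s + h) ^ (-2 : ℝ) := by
          rw [← Real.rpow_add hsh]
          ring_nf
        _ ≤ (3 * h) ^ (2 + β) * (s + h) ^ (-2 : ℝ) := by
          gcongr
          linarith
        _ = _ := by rw [Real.mul_rpow (by norm_num) hh.le, mul_assoc]
    have e5 := mul_le_mul_of_nonneg_left e4 (by positivity : 0 ≤ 2 * C₁)
    nlinarith [mul_nonneg p3 p1, mul_nonneg p4 p1, mul_nonneg p4 p2]
  · have e1 := h₂ a b (by linarith [hs.1, hs.2]) hab.le (by linarith [hs.2]) hbT θ η hθ0 hη0 hsum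
    rw [hcomb] at e1
    have e2 : b ^ (γ - 2) ≤ (2 / 3) ^ (γ - 2) * (s + h) ^ (γ - 2) := by
      rw [← Real.mul_rpow (by norm_num) hsh.le]
      exact Real.rpow_le_rpow_of_nonpos (by linarith) (by linarith [hs.2]) (by linarith)
    have e3 : (b - a) ^ 2 ≤ h ^ 2 := pow_le_pow_left₀ hba.le hbah 2
    have e4 : C₂ * (b - a) ^ 2 * b ^ (γ - 2)
        ≤ C₂ * h ^ 2 * ((2 / 3) ^ (γ - 2) * (s + h) ^ (γ - 2)) := by
      have : 0 ≤ b ^ (γ - 2) := Real.rpow_nonneg (by linarith) _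
      gcongr
    nlinarith [mul_nonneg p3 p1, mul_nonneg p3 p2, mul_nonneg p4 p2]

/-- The quadrature error on a single grid interval, for a right-hand side that is interpolated
with error at most `ρ`. -/
theorem norm_integral_sub_hat_le [CompleteSpace E] {α : ℝ} (hα : 0 < α) {x a b : ℝ} (hab : a < b) (hbx : b ≤ x)
    {g : ℝ → E} (hg : ContinuousOn g (Icc a b)) {ρ : ℝ → ℝ} (hρ : ContinuousOn ρ (Icc a b))
    (hgρ : ∀ s ∈ Icc a b,
      ‖g s - ((b - s) / (b - a)) • g a - ((s - a) / (b - a)) • g b‖ ≤ ρ s) :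
    ‖(Real.Gamma α)⁻¹ • (∫ s in a..b, (x - s) ^ (α - 1) • g s)
        - (hatLeft α x a b • g a + hatRight α x a b • g b)‖
      ≤ (Real.Gamma α)⁻¹ * ∫ s in a..b, (x - s) ^ (α - 1) * ρ s := by
  have hΓ := Real.Gamma_pos_of_pos hα
  have hk := intervalIntegrable_kernel hα x a b
  have i1 : IntervalIntegrable (fun s => (x - s) ^ (α - 1) • g s) volume a b :=
    hk.smul_continuousOn (by rwa [uIcc_of_le hab.le])
  have i2 : IntervalIntegrable (fun s => ((x - s) ^ (α - 1) * ((b - s) / (b - a))) • g a)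
      volume a b := (intervalIntegrable_kernel_hat hα x a b b (b - a)).1.smul_continuousOn
      continuousOn_const
  have i3 : IntervalIntegrable (fun s => ((x - s) ^ (α - 1) * ((s - a) / (b - a))) • g b)
      volume a b := (intervalIntegrable_kernel_hat hα x a b a (b - a)).2.smul_continuousOn
      continuousOn_const
  have h1 : (Real.Gamma α)⁻¹ • (∫ s in a..b, (x - s) ^ (α - 1) • g s)
        - (hatLeft α x a b • g a + hatRight α x a b • g b)
      = (Real.Gamma α)⁻¹ • ∫ s in a..b, (x - s) ^ (α - 1) •
        (g s - ((b - s) / (b - a)) • g a - ((s - a) / (b - a)) • g b) := by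
    simp only [smul_sub ((x - _) ^ (α - 1)), smul_smul]
    rw [intervalIntegral.integral_sub (i1.sub i2) i3, intervalIntegral.integral_sub i1 i2,
      intervalIntegral.integral_smul_const, intervalIntegral.integral_smul_const, hatLeft, hatRight]
    module
  rw [h1, norm_smul, norm_inv, Real.norm_of_nonneg hΓ.le]
  refine mul_le_mul_of_nonneg_left ?_ (inv_nonneg.2 hΓ.le)
  refine intervalIntegral.norm_integral_le_of_norm_le hab.le
    (Filter.Eventually.of_forall fun s hs => ?_)
    (hk.mul_continuousOn (by rwa [uIcc_of_le hab.le]))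
  have hks : 0 ≤ (x - s) ^ (α - 1) := Real.rpow_nonneg (by linarith [hs.2]) _
  rw [norm_smul, Real.norm_of_nonneg hks]
  exact mul_le_mul_of_nonneg_left (hgρ s ⟨hs.1.le, hs.2⟩) hks

end LocalError

/-! ### Grids and the truncation error -/

section Truncation

/-- The first `n` steps of a grid that starts at `0`, stays in `[0, T]`, and has steps of size at
most `h`. -/
structure IsInitialGrid (T h : ℝ) (n : ℕ) (x : ℕ → ℝ) : Prop where
  zero : x 0 = 0
  le_length : x n ≤ T
  lt_succ : ∀ j < n, x j < x (j + 1)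
  step_le : ∀ j < n, x (j + 1) - x j ≤ h

namespace IsInitialGrid

variable {T h : ℝ} {n : ℕ} {x : ℕ → ℝ}

theorem mono (hx : IsInitialGrid T h n x) {i j : ℕ} (hij : i ≤ j) (hj : j ≤ n) : x i ≤ x j := by
  induction j, hij using Nat.le_induction with
  | base => exact le_rfl
  | succ k hk ih => exact (ih (by omega)).trans (hx.lt_succ k (by omega)).le

theorem nonneg (hx : IsInitialGrid T h n x) {j : ℕ} (hj : j ≤ n) : 0 ≤ x j :=
  hx.zero ▸ hx.mono (Nat.zero_le j) hj

theorem le_right (hx : IsInitialGrid T h n x) {j : ℕ} (hj : j ≤ n) : x j ≤ T :=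
  (hx.mono hj le_rfl).trans hx.le_length

theorem take (hx : IsInitialGrid T h n x) {k : ℕ} (hk : k ≤ n) : IsInitialGrid T h k x where
  zero := hx.zero
  le_length := hx.le_right hk
  lt_succ j hj := hx.lt_succ j (hj.trans_le hk)
  step_le j hj := hx.step_le j (hj.trans_le hk)

end IsInitialGrid

theorem continuousOn_errorProfile (α : ℝ) {h a b : ℝ} (hh : 0 < h) (ha : 0 ≤ a) :
    ContinuousOn (errorProfile α h) (Icc a b) := by
  unfold errorProfile
  refine ContinuousOn.add (ContinuousOn.mul ?_ continuousOn_const) continuousOn_const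
  exact ContinuousOn.rpow_const (by fun_prop) fun s hs => Or.inl (by linarith [hs.1])

theorem continuousOn_interpolationProfile (β γ : ℝ) {h a b : ℝ} (hh : 0 < h) (ha : 0 ≤ a) :
    ContinuousOn (interpolationProfile β γ h) (Icc a b) := by
  unfold interpolationProfile
  refine ContinuousOn.add (continuousOn_const.mul ?_) (continuousOn_const.mul ?_)
  all_goals exact ContinuousOn.rpow_const (by fun_prop) fun s hs => Or.inl (by linarith [hs.1])

/-- The discrete fractional integral of the error profile over the part of the grid between `x p`
and `x k`. -/
theorem exists_sum_hat_errorProfile_le {α : ℝ} (hα : 0 < α) :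
    ∃ K : ℝ, 0 ≤ K ∧ ∀ (T h : ℝ) (n : ℕ) (x : ℕ → ℝ), 0 < h → IsInitialGrid T h n x →
      ∀ p k, p ≤ k → k ≤ n →
      ∑ j ∈ Finset.Ico p k, (hatLeft α (x k) (x j) (x (j + 1)) * errorProfile α h (x j)
          + hatRight α (x k) (x j) (x (j + 1)) * errorProfile α h (x (j + 1)))
        ≤ K * (x k - x p) ^ α * errorProfile α h (x k) := by
  obtain ⟨K, hK0, hK⟩ := exists_integral_kernel_errorProfile_le hα
  have hΓ := Real.Gamma_pos_of_pos hα
  refine ⟨(Real.Gamma α)⁻¹ * 2 * K, by positivity, fun T h n x hh hx p k hpk hk => ?_⟩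
  have hint : ∀ j < n, IntervalIntegrable
      (fun s => (x k - s) ^ (α - 1) * errorProfile α h s) volume (x j) (x (j + 1)) := by
    intro j hj
    refine (intervalIntegrable_kernel hα _ _ _).mul_continuousOn ?_
    rw [uIcc_of_le (hx.lt_succ j hj).le]
    exact continuousOn_errorProfile α hh (hx.nonneg hj.le)
  have hterm : ∀ j ∈ Finset.Ico p k,
      hatLeft α (x k) (x j) (x (j + 1)) * errorProfile α h (x j)
          + hatRight α (x k) (x j) (x (j + 1)) * errorProfile α h (x (j + 1))
        ≤ (Real.Gamma α)⁻¹ * 2 *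
          ∫ s in x j..x (j + 1), (x k - s) ^ (α - 1) * errorProfile α h s := by
    intro j hj
    have hjk := (Finset.mem_Ico.1 hj).2
    have hjn : j < n := hjk.trans_le hk
    have hlt := hx.lt_succ j hjn
    have hxj := hx.nonneg hjn.le
    have hle : x (j + 1) ≤ x k := hx.mono hjk hk
    have hanti := errorProfile_anti α hh hxj hlt.le
    have hR := hatRight_nonneg hα hlt hle
    have h1 : hatLeft α (x k) (x j) (x (j + 1)) * errorProfile α h (x j)
          + hatRight α (x k) (x j) (x (j + 1)) * errorProfile α h (x (j + 1))
        ≤ (hatLeft α (x k) (x j) (x (j + 1)) + hatRight α (x k) (x j) (x (j + 1)))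
          * errorProfile α h (x j) := by
      nlinarith [mul_le_mul_of_nonneg_left hanti hR]
    have h2 : hatLeft α (x k) (x j) (x (j + 1)) + hatRight α (x k) (x j) (x (j + 1))
        = (Real.Gamma α)⁻¹ * ∫ s in x j..x (j + 1), (x k - s) ^ (α - 1) := by
      rw [hatLeft_add_hatRight hα hlt, integral_kernel hα, Real.Gamma_add_one hα.ne']
      have := hα.ne'
      field_simp
    have h3 : (∫ s in x j..x (j + 1), (x k - s) ^ (α - 1)) * errorProfile α h (x j)
        ≤ ∫ s in x j..x (j + 1), 2 * ((x k - s) ^ (α - 1) * errorProfile α h s) := by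
      rw [← intervalIntegral.integral_mul_const]
      refine intervalIntegral.integral_mono_on hlt.le
        ((intervalIntegrable_kernel hα _ _ _).mul_const _) ((hint j hjn).const_mul 2)
        fun s hs => ?_
      have hks : 0 ≤ (x k - s) ^ (α - 1) := Real.rpow_nonneg (by linarith [hs.2]) _
      have := errorProfile_le_two_mul hα hh hxj (s' := s)
        (by linarith [hs.2, hx.step_le j hjn]) (hxj.trans hs.1)
      calc _ ≤ (x k - s) ^ (α - 1) * (2 * errorProfile α h s) :=
            mul_le_mul_of_nonneg_left this hks
        _ = _ := by ring
    rw [intervalIntegral.integral_const_mul] at h3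
    rw [h2, mul_assoc] at h1
    calc _ ≤ _ := h1
      _ ≤ (Real.Gamma α)⁻¹ * (2 * ∫ s in x j..x (j + 1),
            (x k - s) ^ (α - 1) * errorProfile α h s) :=
          mul_le_mul_of_nonneg_left h3 (inv_nonneg.2 hΓ.le)
      _ = _ := by ring
  refine (Finset.sum_le_sum hterm).trans ?_
  rw [← Finset.mul_sum, intervalIntegral.sum_integral_adjacent_intervals_Ico hpk
    fun j hj => hint j (hj.2.trans_le hk)]
  have := hK h (x p) (x k) hh (hx.nonneg (hpk.trans hk)) (hx.mono hpk hk)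
  calc _ ≤ (Real.Gamma α)⁻¹ * 2 * (K * (x k - x p) ^ α * errorProfile α h (x k)) := by gcongr
    _ = _ := by ring

variable {E : Type*} [NormedAddCommGroup E] [NormedSpace ℝ E] [CompleteSpace E]

/-- The truncation error of the product-integration trapezoidal rule. -/
theorem IsSmoothVolterra.exists_truncation_bound {α T M L : ℝ} {P y g : ℝ → E}
    (hv : IsSmoothVolterra α T M L P y g) :
    ∃ C : ℝ, 0 ≤ C ∧ ∀ (h : ℝ) (n : ℕ) (x : ℕ → ℝ), h ∈ Ioc 0 T → IsInitialGrid T h n x →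
      ‖y (x n) - P (x n) - ∑ j ∈ Finset.range n, (hatLeft α (x n) (x j) (x (j + 1)) • g (x j)
          + hatRight α (x n) (x j) (x (j + 1)) • g (x (j + 1)))‖
        ≤ C * errorProfile α h (x n) := by
  have hα := hv.order_pos
  have hΓ := Real.Gamma_pos_of_pos hα
  have hβ : 0 < min α 1 := lt_min hα one_pos
  -- second differences of `g` behave as if its second derivative were `O(s ^ (γ - 2))`
  obtain ⟨γ, hγ0, hγβ, hγα, hγ1, hγ2⟩ : ∃ γ : ℝ, 0 < γ ∧ γ ≤ 2 * min α 1 ∧ (α ≠ 1 → γ ≤ α) ∧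
      (α < 1 → γ = α) ∧ (1 ≤ α → 1 < γ) := by
    rcases lt_trichotomy α 1 with h | h | h
    · exact ⟨α, hα, by rw [min_eq_left h.le]; linarith, fun _ => le_rfl, fun _ => rfl,
        fun h' => absurd h' (not_le.2 h)⟩
    · refine ⟨2, two_pos, by rw [h]; norm_num, fun h' => absurd h h',
        fun h' => absurd h h'.ne, fun _ => one_lt_two⟩
    · refine ⟨min α 2, lt_min hα two_pos, ?_, fun _ => min_le_left _ _,
        fun h' => absurd h' (not_lt.2 h.le), fun _ => lt_min h one_lt_two⟩
      rw [min_eq_right h.le]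
      linarith [min_le_right α 2]
  have hγ2' : γ ≤ 2 := by linarith [min_le_right α 1]
  obtain ⟨C₁, hC₁, h₁⟩ := hv.exists_rhs_holder_bound hβ (min_le_left _ _) (min_le_right _ _)
  obtain ⟨C₂, hC₂, h₂⟩ := hv.exists_rhs_secondDiff_bound hβ (min_le_left _ _) (min_le_right _ _)
    hγ0 hγβ hγα
  obtain ⟨C₃, hC₃, h₃⟩ := exists_interpolation_error_bound hβ hγ2' hC₁ hC₂ h₁ h₂
  obtain ⟨K, hK0, hK⟩ := exists_integral_kernel_interpolationProfile_le hα hv.length_pos hγ1 hγ2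
  refine ⟨(Real.Gamma α)⁻¹ * (C₃ * K), by positivity, fun h n x hh hx => ?_⟩
  have hxn : x n ∈ Icc 0 T := ⟨hx.nonneg le_rfl, hx.le_length⟩
  have hsub : ∀ j < n, Icc (x j) (x (j + 1)) ⊆ Icc 0 T := fun j hj =>
    Icc_subset_Icc (hx.nonneg hj.le) (hx.le_right hj)
  have hint : ∀ j < n, IntervalIntegrable (fun s => (x n - s) ^ (α - 1) • g s) volume
      (x j) (x (j + 1)) := by
    intro j hj
    refine (intervalIntegrable_kernel hα _ _ _).smul_continuousOn ?_
    rw [uIcc_of_le (hx.lt_succ j hj).le]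
    exact hv.continuousOn_rhs.mono (hsub j hj)
  have hint' : ∀ j < n, IntervalIntegrable
      (fun s => (x n - s) ^ (α - 1) * (C₃ * interpolationProfile (min α 1) γ h s)) volume
      (x j) (x (j + 1)) := by
    intro j hj
    refine (intervalIntegrable_kernel hα _ _ _).mul_continuousOn ?_
    rw [uIcc_of_le (hx.lt_succ j hj).le]
    exact continuousOn_const.mul (continuousOn_interpolationProfile _ _ hh.1 (hx.nonneg hj.le))
  have h4 : y (x n) - P (x n) = ∑ j ∈ Finset.range n, (Real.Gamma α)⁻¹ •
      ∫ s in x j..x (j + 1), (x n - s) ^ (α - 1) • g s := by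
    rw [← Finset.smul_sum, intervalIntegral.sum_integral_adjacent_intervals hint, hx.zero, hv.equation _ hxn]
    abel
  rw [h4, ← Finset.sum_sub_distrib]
  refine (norm_sum_le _ _).trans ((Finset.sum_le_sum (g := fun j => (Real.Gamma α)⁻¹ *
    ∫ s in x j..x (j + 1), (x n - s) ^ (α - 1) * (C₃ * interpolationProfile (min α 1) γ h s))
    fun j hj => ?_).trans ?_)
  · have hjn := Finset.mem_range.1 hj
    exact norm_integral_sub_hat_le hα (hx.lt_succ j hjn) (hx.mono hjn le_rfl)
      (hv.continuousOn_rhs.mono (hsub j hjn))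
      (continuousOn_const.mul (continuousOn_interpolationProfile _ _ hh.1 (hx.nonneg hjn.le)))
      fun s hs => h₃ h _ _ s hh.1 (hx.nonneg hjn.le) (hx.lt_succ j hjn) (hx.le_right hjn)
        (hx.step_le j hjn) hs
  · rw [← Finset.mul_sum, intervalIntegral.sum_integral_adjacent_intervals hint', hx.zero]
    simp only [mul_left_comm _ C₃]
    rw [intervalIntegral.integral_const_mul]
    have := hK h hh (x n) hxn
    calc _ ≤ (Real.Gamma α)⁻¹ * (C₃ * (K * errorProfile α h (x n))) :=
          mul_le_mul_of_nonneg_left (mul_le_mul_of_nonneg_left this hC₃) (inv_nonneg.2 hΓ.le)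
      _ = _ := by ring

end Truncation

/-! ### A discrete Gronwall inequality -/

section DiscreteGronwall

/-- A system of implicit discrete Volterra inequalities for an error sequence `e` on a grid `x`,
together with a weight `V` on which the discrete operator with coefficients `A`, `B` acts like a
fractional integral of order `α`: over a short part of the grid it is a small multiple of `V`.
The coefficient of the implicit term is bounded away from `1`. -/
structure IsGronwallSystem (α T K L c₀ C₀ : ℝ) (n : ℕ) (x V e : ℕ → ℝ) (A B : ℕ → ℕ → ℝ) :
    Prop where
  zero : x 0 = 0
  le_length : x n ≤ T
  lt_succ : ∀ j < n, x j < x (j + 1)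
  weight_pos : ∀ k ≤ n, 0 < V k
  left_nonneg : ∀ k ≤ n, ∀ j < k, 0 ≤ A k j
  right_nonneg : ∀ k ≤ n, ∀ j < k, 0 ≤ B k j
  sum_le : ∀ p k, p ≤ k → k ≤ n →
    ∑ j ∈ Finset.Ico p k, (A k j * V j + B k j * V (j + 1)) ≤ K * (x k - x p) ^ α * V k
  implicit_le : ∀ k < n, L * B (k + 1) k ≤ 1 - c₀
  error_nonneg : ∀ k ≤ n, 0 ≤ e k
  error_zero : e 0 = 0
  error_le : ∀ k, 1 ≤ k → k ≤ n →
    e k ≤ C₀ * V k + L * ∑ j ∈ Finset.range k, (A k j * e j + B k j * e (j + 1))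

namespace IsGronwallSystem

variable {α T K L c₀ C₀ : ℝ} {n : ℕ} {x V e : ℕ → ℝ} {A B : ℕ → ℕ → ℝ}

theorem mono (hs : IsGronwallSystem α T K L c₀ C₀ n x V e A B) {i j : ℕ} (hij : i ≤ j)
    (hj : j ≤ n) : x i ≤ x j := by
  induction j, hij using Nat.le_induction with
  | base => exact le_rfl
  | succ k hk ih => exact (ih (by omega)).trans (hs.lt_succ k (by omega)).le

/-- A bound on the first errors, up to the index `p`, extends to one more error and to all the
errors at distance at most `d` from `x p`. -/
theorem error_le_of_window (hs : IsGronwallSystem α T K L c₀ C₀ n x V e A B) (hα : 0 < α)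
    (hK : 0 ≤ K) (hL : 0 ≤ L) (hc₀ : 0 < c₀) (hC₀ : 0 ≤ C₀) {d : ℝ}
    (hd : L * (K * d ^ α) ≤ c₀ / 2) {M : ℝ} (hM : 0 ≤ M) {p : ℕ}
    (hpM : ∀ j ≤ p, e j ≤ M * V j) :
    ∀ k ≤ n, (k ≤ p + 1 ∨ x k - x p ≤ d) →
      e k ≤ (M + 2 * (C₀ + L * (K * T ^ α) * M) / c₀) * V k := by
  have hT : 0 ≤ T := (hs.zero ▸ hs.mono (Nat.zero_le n) le_rfl).trans hs.le_length
  have hTα : 0 ≤ T ^ α := Real.rpow_nonneg hT _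
  set Φ := M + 2 * (C₀ + L * (K * T ^ α) * M) / c₀ with hΦ
  have hMΦ : M ≤ Φ := by
    rw [hΦ]
    have : 0 ≤ 2 * (C₀ + L * (K * T ^ α) * M) / c₀ := by positivity
    linarith
  have hΦc : c₀ * (Φ - M) = 2 * (C₀ + L * (K * T ^ α) * M) := by
    rw [hΦ]
    field_simp
    ring
  have hΦ0 : 0 ≤ Φ := hM.trans hMΦ
  intro k
  induction k using Nat.strong_induction_on with
  | _ k ih =>
  intro hk hcase
  have hVk := hs.weight_pos k hk
  rcases le_or_gt k p with hkp | hkp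
  · exact (hpM k hkp).trans (mul_le_mul_of_nonneg_right hMΦ hVk.le)
  obtain ⟨q, rfl⟩ : ∃ q, k = q + 1 := ⟨k - 1, by omega⟩
  have hxk : x (q + 1) ≤ T := (hs.mono hk le_rfl).trans hs.le_length
  -- the errors with the implicit one removed
  let e' : ℕ → ℝ := fun j => if j ≤ q then e j else 0
  have he' : ∀ j ≤ q, e' j = e j := fun j hj => if_pos hj
  have he'q : e' (q + 1) = 0 := if_neg (by omega)
  have hA := hs.left_nonneg (q + 1) hk
  have hB := hs.right_nonneg (q + 1) hk
  have hsplit : ∑ j ∈ Finset.range (q + 1), (A (q + 1) j * e j + B (q + 1) j * e (j + 1))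
      = ∑ j ∈ Finset.range (q + 1), (A (q + 1) j * e' j + B (q + 1) j * e' (j + 1))
        + B (q + 1) q * e (q + 1) := by
    rw [Finset.sum_range_succ, Finset.sum_range_succ, he'q, he' q le_rfl,
      Finset.sum_congr rfl fun j hj => ?_]
    · ring
    · have := Finset.mem_range.1 hj
      rw [he' j (by omega), he' (j + 1) (by omega)]
  have hcmp : ∀ (R : ℝ) (a b : ℕ), b ≤ q + 1 →
      (∀ j, j ≤ b → e' j ≤ R * V j) →
      ∑ j ∈ Finset.Ico a b, (A (q + 1) j * e' j + B (q + 1) j * e' (j + 1))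
        ≤ R * ∑ j ∈ Finset.Ico a b, (A (q + 1) j * V j + B (q + 1) j * V (j + 1)) := by
    intro R a b hb hR
    rw [Finset.mul_sum]
    refine Finset.sum_le_sum fun j hj => ?_
    have hjb := (Finset.mem_Ico.1 hj).2
    have h1 := mul_le_mul_of_nonneg_left (hR j hjb.le) (hA j (by omega))
    have h2 := mul_le_mul_of_nonneg_left (hR (j + 1) hjb) (hB j (by omega))
    calc _ ≤ _ := add_le_add h1 h2
      _ = _ := by ring
  have hfull : ∑ j ∈ Finset.Ico 0 (q + 1), (A (q + 1) j * V j + B (q + 1) j * V (j + 1))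
      ≤ K * T ^ α * V (q + 1) := by
    refine (hs.sum_le 0 (q + 1) (Nat.zero_le _) hk).trans ?_
    rw [hs.zero, sub_zero]
    have hx0 : 0 ≤ x (q + 1) := hs.zero ▸ hs.mono (Nat.zero_le _) hk
    have := Real.rpow_le_rpow hx0 hxk hα.le
    gcongr
  have hterm0 : ∀ j ∈ Finset.Ico 0 (q + 1), 0 ≤ A (q + 1) j * V j + B (q + 1) j * V (j + 1) := by
    intro j hj
    have hjq := (Finset.mem_Ico.1 hj).2
    have h1 := mul_nonneg (hA j hjq) (hs.weight_pos j (by omega)).le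
    have h2 := mul_nonneg (hB j hjq) (hs.weight_pos (j + 1) (by omega)).le
    linarith
  have hsum : L * ∑ j ∈ Finset.range (q + 1), (A (q + 1) j * e' j + B (q + 1) j * e' (j + 1))
      ≤ L * (K * T ^ α) * M * V (q + 1) + c₀ / 2 * Φ * V (q + 1) := by
    rw [Finset.range_eq_Ico]
    have hn1 : 0 ≤ c₀ / 2 * Φ * V (q + 1) := by positivity
    rcases Nat.lt_or_ge p q with hpq | hpq
    · have h1 : ∑ j ∈ Finset.Ico 0 p, (A (q + 1) j * e' j + B (q + 1) j * e' (j + 1))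
          ≤ M * (K * T ^ α * V (q + 1)) := by
        refine (hcmp M 0 p (by omega) fun j hj => ?_).trans (mul_le_mul_of_nonneg_left
          ((Finset.sum_le_sum_of_subset_of_nonneg ?_ fun j hj _ => hterm0 j hj).trans hfull) hM)
        · rw [he' j (by omega)]
          exact hpM j hj
        · exact Finset.Ico_subset_Ico le_rfl (by omega)
      have hxd : x (q + 1) - x p ≤ d := by
        rcases hcase with h | h
        · omega
        · exact h
      have h2 : ∑ j ∈ Finset.Ico p (q + 1), (A (q + 1) j * e' j + B (q + 1) j * e' (j + 1))
          ≤ Φ * (K * d ^ α * V (q + 1)) := by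
        refine (hcmp Φ p (q + 1) le_rfl fun j hj => ?_).trans (mul_le_mul_of_nonneg_left
          ((hs.sum_le p (q + 1) hkp.le hk).trans ?_) hΦ0)
        · rcases Nat.lt_or_ge q j with hjq | hjq
          · obtain rfl : j = q + 1 := by omega
            rw [he'q]
            positivity
          · rw [he' j hjq]
            have hmono := hs.mono (i := j) (j := q + 1) (by omega) hk
            exact ih j (by omega) (by omega) (Or.inr (by linarith))
        · have h0 : 0 ≤ x (q + 1) - x p := sub_nonneg.2 (hs.mono hkp.le hk)
          have := Real.rpow_le_rpow h0 hxd hα.le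
          gcongr
      rw [← Finset.sum_Ico_consecutive _ (Nat.zero_le p) hkp.le, mul_add]
      refine add_le_add ((mul_le_mul_of_nonneg_left h1 hL).trans_eq (by ring))
        ((mul_le_mul_of_nonneg_left h2 hL).trans ?_)
      calc L * (Φ * (K * d ^ α * V (q + 1))) = L * (K * d ^ α) * (Φ * V (q + 1)) := by ring
        _ ≤ c₀ / 2 * (Φ * V (q + 1)) := by gcongr
        _ = _ := by ring
    · obtain rfl : p = q := by omega
      have h1 : ∑ j ∈ Finset.Ico 0 (p + 1), (A (p + 1) j * e' j + B (p + 1) j * e' (j + 1))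
          ≤ M * (K * T ^ α * V (p + 1)) := by
        refine (hcmp M 0 (p + 1) le_rfl fun j hj => ?_).trans
          (mul_le_mul_of_nonneg_left hfull hM)
        rcases Nat.lt_or_ge p j with hjq | hjq
        · obtain rfl : j = p + 1 := by omega
          rw [he'q]
          positivity
        · rw [he' j hjq]
          exact hpM j hjq
      have h2 := mul_le_mul_of_nonneg_left h1 hL
      linarith
  have hmain := hs.error_le (q + 1) (by omega) hk
  rw [hsplit] at hmain
  have himp := mul_le_mul_of_nonneg_right (hs.implicit_le q (by omega))
    (hs.error_nonneg (q + 1) hk)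
  have h1 : c₀ * e (q + 1) ≤ (C₀ + L * (K * T ^ α) * M + c₀ / 2 * Φ) * V (q + 1) := by
    linarith
  have h2 : C₀ + L * (K * T ^ α) * M + c₀ / 2 * Φ ≤ c₀ * Φ := by
    have : 0 ≤ c₀ * M := by positivity
    linarith
  have h3 : c₀ * e (q + 1) ≤ c₀ * (Φ * V (q + 1)) := by
    rw [← mul_assoc c₀]
    exact h1.trans (mul_le_mul_of_nonneg_right h2 hVk.le)
  exact le_of_mul_le_mul_left h3 hc₀

end IsGronwallSystem

/-- A discrete Gronwall inequality that is uniform in the grid. The interval is cut into windows so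
short that the discrete operator contracts on each of them. The grid steps need not be small
compared to a window: the first grid point of a window is reached by a single implicit step. -/
theorem exists_discrete_gronwall_bound {α T K L c₀ C₀ : ℝ} (hα : 0 < α) (hK : 0 ≤ K) (hL : 0 ≤ L)
    (hc₀ : 0 < c₀) (hC₀ : 0 ≤ C₀) (hT : 0 ≤ T) :
    ∃ C : ℝ, 0 ≤ C ∧ ∀ (n : ℕ) (x V e : ℕ → ℝ) (A B : ℕ → ℕ → ℝ),
      IsGronwallSystem α T K L c₀ C₀ n x V e A B → ∀ k ≤ n, e k ≤ C * V k := by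
  -- the window length, for which the coefficients of a window contribute at most `c₀ / 2`
  set d : ℝ := (c₀ / (2 * (L * K + 1))) ^ (1 / α) with hd
  have hb : 0 < c₀ / (2 * (L * K + 1)) := by positivity
  have hd0 : 0 < d := Real.rpow_pos_of_pos hb _
  have hdα : L * (K * d ^ α) ≤ c₀ / 2 := by
    rw [hd, ← Real.rpow_mul hb.le, one_div_mul_cancel hα.ne', Real.rpow_one]
    rw [← mul_assoc, mul_div_assoc', div_le_div_iff₀ (by positivity) two_pos]
    nlinarith [mul_nonneg hL hK]
  have hwin : ∀ i : ℕ, ∃ M : ℝ, 0 ≤ M ∧ ∀ (n : ℕ) (x V e : ℕ → ℝ) (A B : ℕ → ℕ → ℝ),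
      IsGronwallSystem α T K L c₀ C₀ n x V e A B → ∀ k ≤ n, x k ≤ i * d → e k ≤ M * V k := by
    intro i
    induction i with
    | zero =>
      refine ⟨0, le_rfl, fun n x V e A B hs k hk hxk => ?_⟩
      rw [Nat.cast_zero, zero_mul] at hxk
      rcases Nat.eq_zero_or_pos k with rfl | hk0
      · rw [hs.error_zero, zero_mul]
      · have h1 := hs.lt_succ 0 (by omega)
        have h2 := hs.mono (i := 0 + 1) (j := k) (by omega) hk
        rw [hs.zero] at h1
        linarith
    | succ i ih =>
      obtain ⟨M, hM0, hM⟩ := ih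
      have hTα : 0 ≤ T ^ α := Real.rpow_nonneg hT _
      set M₁ := M + 2 * (C₀ + L * (K * T ^ α) * M) / c₀ with hM₁
      have hM₁0 : 0 ≤ M₁ := by positivity
      set M₂ := M₁ + 2 * (C₀ + L * (K * T ^ α) * M₁) / c₀ with hM₂
      have h12 : M₁ ≤ M₂ := by
        have : 0 ≤ 2 * (C₀ + L * (K * T ^ α) * M₁) / c₀ := by positivity
        linarith
      have h01 : M ≤ M₁ := by
        have : 0 ≤ 2 * (C₀ + L * (K * T ^ α) * M) / c₀ := by positivity
        linarith
      refine ⟨M₂, by positivity, fun n x V e A B hs k hk hxk => ?_⟩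
      by_cases hki : x k ≤ i * d
      · exact (hM n x V e A B hs k hk hki).trans
          (mul_le_mul_of_nonneg_right (h01.trans h12) (hs.weight_pos k hk).le)
      · -- the first grid point of the window
        have hex : ∃ j, ¬ x j ≤ i * d := ⟨k, hki⟩
        classical
        have hmin : ∀ j, j < Nat.find hex → x j ≤ i * d := fun j hj =>
          not_not.1 (Nat.find_min hex hj)
        have hspec := Nat.find_spec hex
        have hlek : Nat.find hex ≤ k := Nat.find_min' hex hki
        have hpos : Nat.find hex ≠ 0 := by
          intro h0
          rw [h0, hs.zero] at hspec
          exact hspec (by positivity)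
        obtain ⟨p, hp⟩ := Nat.exists_eq_succ_of_ne_zero hpos
        rw [hp, Nat.succ_eq_add_one] at hspec hlek hmin
        have hstep₁ : ∀ j ≤ p + 1, e j ≤ M₁ * V j := fun j hj =>
          hs.error_le_of_window hα hK hL hc₀ hC₀ hdα hM0 (p := p)
            (fun j' hj' => hM n x V e A B hs j' (by omega) (hmin j' (by omega))) j (by omega)
            (Or.inl hj)
        refine hs.error_le_of_window hα hK hL hc₀ hC₀ hdα hM₁0 (p := p + 1)
          hstep₁ k hk (Or.inr ?_)
        push_cast at hxk
        linarith [not_le.1 hspec]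
  obtain ⟨M, hM0, hM⟩ := hwin ⌈T / d⌉₊
  refine ⟨M, hM0, fun n x V e A B hs k hk => hM n x V e A B hs k hk ?_⟩
  refine ((hs.mono hk le_rfl).trans hs.le_length).trans ?_
  rw [← div_le_iff₀ hd0]
  exact Nat.le_ceil _

end DiscreteGronwall

/-! ### The error estimate -/

section Assembly

variable {E : Type*} [NormedAddCommGroup E] [NormedSpace ℝ E]

/-- First and second differences of the superposition operator of a `C²` function that is
Lipschitz in its second variable, over values in a ball. -/
theorem exists_superposition_bounds [FiniteDimensional ℝ E] {t₀ T : ℝ} (hT : t₀ < T)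
    {f : ℝ → E → E} (hf : ContDiffOn ℝ 2 (Function.uncurry f) (Icc t₀ T ×ˢ univ)) {L : NNReal}
    (hL : ∀ t ∈ Icc t₀ T, LipschitzWith L (f t)) (R : ℝ) :
    ∃ M : ℝ, 0 ≤ M ∧
      (∀ a ∈ Icc t₀ T, ∀ b ∈ Icc t₀ T, ∀ u v : E, ‖u‖ ≤ R → ‖v‖ ≤ R →
        ‖f b v - f a u‖ ≤ M * (|b - a| + ‖v - u‖)) ∧
      (∀ a ∈ Icc t₀ T, ∀ b ∈ Icc t₀ T, ∀ u v w : E, ‖u‖ ≤ R → ‖v‖ ≤ R → ∀ θ η : ℝ, 0 ≤ θ →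
        0 ≤ η → θ + η = 1 →
        ‖f (θ * a + η * b) w - θ • f a u - η • f b v‖
          ≤ L * ‖w - θ • u - η • v‖ + M * (|b - a| ^ 2 + ‖v - u‖ ^ 2)) := by
  have hproper : ProperSpace E := FiniteDimensional.proper_real E
  have hS : UniqueDiffOn ℝ (Icc t₀ T ×ˢ (univ : Set E)) :=
    (uniqueDiffOn_Icc hT).prod uniqueDiffOn_univ
  have hK : IsCompact (Icc t₀ T ×ˢ Metric.closedBall (0 : E) R) :=
    isCompact_Icc.prod (isCompact_closedBall _ _)
  have hKc : Convex ℝ (Icc t₀ T ×ˢ Metric.closedBall (0 : E) R) :=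
    (convex_Icc _ _).prod (convex_closedBall _ _)
  have hKS : Icc t₀ T ×ˢ Metric.closedBall (0 : E) R ⊆ Icc t₀ T ×ˢ (univ : Set E) :=
    prod_mono le_rfl (subset_univ _)
  obtain ⟨M₁, hM₁0, hM₁⟩ := exists_lipschitz_bound_of_contDiffOn
    (hf.of_le (m := 1) (by norm_num)) hS hK hKc hKS
  obtain ⟨M₂, hM₂0, hM₂⟩ := exists_secondDiff_bound_of_contDiffOn hf hS hK hKc hKS
  have hmem : ∀ a ∈ Icc t₀ T, ∀ u : E, ‖u‖ ≤ R →
      (a, u) ∈ Icc t₀ T ×ˢ Metric.closedBall (0 : E) R := fun a ha u hu =>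
    ⟨ha, mem_closedBall_zero_iff.2 hu⟩
  refine ⟨max M₁ M₂, hM₁0.trans (le_max_left _ _), fun a ha b hb u v hu hv => ?_,
    fun a ha b hb u v w hu hv θ η hθ hη hsum => ?_⟩
  · have h1 := hM₁ _ (hmem a ha u hu) _ (hmem b hb v hv)
    refine h1.trans (mul_le_mul (le_max_left _ _) ?_ (norm_nonneg _)
      (hM₁0.trans (le_max_left _ _)))
    rw [Prod.mk_sub_mk, Prod.norm_mk, Real.norm_eq_abs]
    exact max_le_add_of_nonneg (abs_nonneg _) (norm_nonneg _)
  · have h1 := hM₂ _ (hmem a ha u hu) _ (hmem b hb v hv) θ η hθ hη hsum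
    simp only [Prod.smul_mk, Prod.mk_add_mk, Function.uncurry_apply_pair, smul_eq_mul] at h1
    have hab : θ * a + η * b ∈ Icc t₀ T := convex_Icc _ _ ha hb hθ hη hsum
    have h2 := (hL _ hab).norm_sub_le w (θ • u + η • v)
    have h3 : ‖((b, v) : ℝ × E) - (a, u)‖ ^ 2 ≤ |b - a| ^ 2 + ‖v - u‖ ^ 2 := by
      rw [Prod.mk_sub_mk, Prod.norm_mk, Real.norm_eq_abs]
      rcases max_cases |b - a| ‖v - u‖ with h | h
      · rw [h.1]
        linarith [sq_nonneg ‖v - u‖]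
      · rw [h.1]
        linarith [sq_nonneg |b - a|]
    have h4 : M₂ * ‖((b, v) : ℝ × E) - (a, u)‖ ^ 2
        ≤ max M₁ M₂ * (|b - a| ^ 2 + ‖v - u‖ ^ 2) :=
      mul_le_mul (le_max_right _ _) h3 (sq_nonneg _) (hM₁0.trans (le_max_left _ _))
    have h5 : f (θ * a + η * b) w - θ • f a u - η • f b v
        = (f (θ * a + η * b) w - f (θ * a + η * b) (θ • u + η • v))
          + (f (θ * a + η * b) (θ • u + η • v) - θ • f a u - η • f b v) := by abel
    rw [h5, sub_sub w]
    exact (norm_add_le _ _).trans (add_le_add h2 (h1.trans h4))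

/-- Translated to the initial point `0`, a solution of the Caputo initial value problem and its
right-hand side form the data of a smooth Volterra equation. -/
theorem IsCaputoSolution.exists_isSmoothVolterra [FiniteDimensional ℝ E] {α t₀ T : ℝ} (hα : 0 < α)
    (hT : t₀ < T) {f : ℝ → E → E}
    (hf : ContDiffOn ℝ 2 (Function.uncurry f) (Icc t₀ T ×ˢ univ)) {L : NNReal}
    (hL : ∀ t ∈ Icc t₀ T, LipschitzWith L (f t)) {y₀ : ℕ → E} {y : ℝ → E}
    (hy : IsCaputoSolution α t₀ T f y₀ y) :
    ∃ M : ℝ, IsSmoothVolterra α (T - t₀) M L (fun s => initialTaylor α t₀ y₀ (t₀ + s))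
      (fun s => y (t₀ + s)) (fun s => f (t₀ + s) (y (t₀ + s))) := by
  have hcomplete : CompleteSpace E := FiniteDimensional.complete ℝ E
  have hyc : ContinuousOn y (Icc t₀ T) := hy.contDiffOn.continuousOn
  obtain ⟨R, hR⟩ := isCompact_Icc.exists_bound_of_continuousOn hyc
  obtain ⟨M, hM0, hM₁, hM₂⟩ := exists_superposition_bounds hT hf hL R
  have hmem : ∀ s ∈ Icc 0 (T - t₀), t₀ + s ∈ Icc t₀ T := fun s hs =>
    ⟨by linarith [hs.1], by linarith [hs.2]⟩
  have hyc' : ContinuousOn (fun s => y (t₀ + s)) (Icc 0 (T - t₀)) :=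
    hyc.comp (by fun_prop) hmem
  refine ⟨M, hα, sub_pos.2 hT, hM0, L.coe_nonneg, ?_, hyc', ?_, fun s hs => ?_,
    fun a ha b hb => ?_, fun a ha b hb θ η hθ hη hsum => ?_⟩
  · unfold initialTaylor
    fun_prop
  · exact hf.continuousOn.comp (f := fun s => (t₀ + s, y (t₀ + s)))
      (ContinuousOn.prodMk (by fun_prop) hyc') fun s hs => ⟨hmem s hs, mem_univ _⟩
  · have h1 := hy.volterra hα hT (hmem s hs)
    have h2 := intervalIntegral.integral_comp_add_left (a := 0) (b := s)
      (fun r => (t₀ + s - r) ^ (α - 1) • f r (y r)) t₀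
    rw [add_zero] at h2
    rw [h1, ← h2]
    simp only [add_sub_add_left_eq_sub]
  · have := hM₁ _ (hmem a ha) _ (hmem b hb) _ _ (hR _ (hmem a ha)) (hR _ (hmem b hb))
    rwa [add_sub_add_left_eq_sub] at this
  · have := hM₂ _ (hmem a ha) _ (hmem b hb) _ _ (y (t₀ + (θ * a + η * b)))
      (hR _ (hmem a ha)) (hR _ (hmem b hb)) θ η hθ hη hsum
    have e : θ * (t₀ + a) + η * (t₀ + b) = t₀ + (θ * a + η * b) := by
      linear_combination t₀ * hsum
    rwa [add_sub_add_left_eq_sub, e] at this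

theorem step_le_maxStep (t : ℕ → ℝ) {n j : ℕ} (hj : j < n) : step t j ≤ maxStep t n :=
  le_ciSup (f := fun j : Fin n => step t j) (Set.finite_range _).bddAbove ⟨j, hj⟩

theorem weight_translate (α t₀ : ℝ) (t : ℕ → ℝ) (n j : ℕ) :
    weight α (fun i => t i - t₀) n j = weight α t n j := by
  simp only [weight, moment, step, sub_sub_sub_cancel_right]

theorem weightZero_translate (α t₀ : ℝ) (t : ℕ → ℝ) (n : ℕ) :
    weightZero α (fun i => t i - t₀) n = weightZero α t n := by
  simp only [weightZero, moment, step, sub_sub_sub_cancel_right]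

/-- The error estimate in terms of the error profile. -/
theorem exists_error_le_errorProfile [FiniteDimensional ℝ E] {α t₀ T : ℝ} (hα : 0 < α)
    (hT : t₀ < T) {f : ℝ → E → E}
    (hf : ContDiffOn ℝ 2 (Function.uncurry f) (Icc t₀ T ×ˢ univ)) {L : NNReal}
    (hL : ∀ t ∈ Icc t₀ T, LipschitzWith L (f t)) {y₀ : ℕ → E} {y : ℝ → E}
    (hy : IsCaputoSolution α t₀ T f y₀ y) {hbar : ℝ}
    (hbar_lt : (L : ℝ) * hbar ^ α < Real.Gamma (α + 2)) :
    ∃ C : ℝ, 0 ≤ C ∧ ∀ (N : ℕ) (t : ℕ → ℝ) (u : ℕ → E),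
      IsGrid t₀ T N t → IsPITrapezoidal α f y₀ N t u →
      ∀ n, 1 ≤ n → n ≤ N → maxStep t n ≤ hbar →
        0 < maxStep t n ∧ maxStep t n ≤ T - t₀ ∧
        ‖y (t n) - u n‖ ≤ C * errorProfile α (maxStep t n) (t n - t₀) := by
  have hcomplete : CompleteSpace E := FiniteDimensional.complete ℝ E
  obtain ⟨M, hv⟩ := hy.exists_isSmoothVolterra hα hT hf hL
  obtain ⟨C₀, hC₀, htrunc⟩ := hv.exists_truncation_bound
  obtain ⟨K, hK0, hK⟩ := exists_sum_hat_errorProfile_le hα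
  have hΓ2 : 0 < Real.Gamma (α + 2) := Real.Gamma_pos_of_pos (by linarith)
  -- the implicit coefficient stays below `1 - c₀`
  set c₀ := 1 - L * hbar ^ α / Real.Gamma (α + 2) with hc₀
  have hc₀pos : 0 < c₀ := by
    rw [hc₀, sub_pos, div_lt_one hΓ2]
    exact hbar_lt
  obtain ⟨C, hC0, hC⟩ := exists_discrete_gronwall_bound (C₀ := C₀) hα hK0 L.coe_nonneg hc₀pos hC₀
    (sub_pos.2 hT).le
  refine ⟨C, hC0, fun N t u ht hu n hn hnN hmax => ?_⟩
  set h := maxStep t n with hh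
  let x : ℕ → ℝ := fun j => t j - t₀
  have hstep : ∀ j < n, x (j + 1) - x j ≤ h := fun j hj => by
    simp only [x, sub_sub_sub_cancel_right]
    exact step_le_maxStep t hj
  have hlt : ∀ j < N, x j < x (j + 1) := fun j hj => sub_lt_sub_right (ht.lt_succ j hj) t₀
  have hx0 : x 0 = 0 := sub_eq_zero.2 ht.left
  have hgridN : IsInitialGrid (T - t₀) (maxStep t N) N x := by
    refine ⟨hx0, by simp only [x, ht.right, le_refl], hlt, fun j hj => ?_⟩
    simp only [x, sub_sub_sub_cancel_right]
    exact step_le_maxStep t hj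
  have hxT : ∀ k ≤ N, x k ≤ T - t₀ := fun k hk => hgridN.le_right hk
  have hpos : 0 < h := by
    have h1 := hlt 0 (by omega)
    have h2 := hstep 0 (by omega)
    linarith
  have hle : h ≤ T - t₀ := by
    have : Nonempty (Fin n) := ⟨⟨0, hn⟩⟩
    refine ciSup_le fun j => ?_
    have h1 := hxT (j + 1) (by have := j.2; omega)
    have h2 := hgridN.nonneg (j := j) (by have := j.2; omega)
    simp only [x] at h1 h2
    rw [step]
    linarith
  have hgrid : IsInitialGrid (T - t₀) h n x :=
    ⟨hx0, hxT n hnN, fun j hj => hlt j (hj.trans_le hnN), hstep⟩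
  refine ⟨hpos, hle, ?_⟩
  have htx : ∀ j, t₀ + x j = t j := fun j => by simp only [x]; ring
  have hsys : IsGronwallSystem α (T - t₀) K L c₀ C₀ n x (fun j => errorProfile α h (x j))
      (fun j => ‖y (t j) - u j‖) (fun k j => hatLeft α (x k) (x j) (x (j + 1)))
      (fun k j => hatRight α (x k) (x j) (x (j + 1))) := by
    refine ⟨hx0, hxT n hnN, hgrid.lt_succ, fun k hk => errorProfile_pos α hpos (hgrid.nonneg hk),
      fun k hk j hj => hatLeft_nonneg hα (hgrid.lt_succ j (hj.trans_le hk)) (hgrid.mono hj hk),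
      fun k hk j hj => hatRight_nonneg hα (hgrid.lt_succ j (hj.trans_le hk)) (hgrid.mono hj hk),
      hK _ _ _ _ hpos hgrid, fun k hk => ?_, fun k _ => norm_nonneg _, ?_, fun k hk1 hk => ?_⟩
    · have hd : 0 < x (k + 1) - x k := sub_pos.2 (hgrid.lt_succ k hk)
      have h1 : hatRight α (x (k + 1)) (x k) (x (k + 1))
          = (x (k + 1) - x k) ^ α / Real.Gamma (α + 2) := by
        rw [hatRight_eq hα (hgrid.lt_succ k hk) le_rfl, sub_self, Real.zero_rpow hα.ne',
          Real.zero_rpow (by linarith), Real.rpow_add_one hd.ne']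
        field_simp
        ring
      have h2 : (x (k + 1) - x k) ^ α ≤ hbar ^ α :=
        Real.rpow_le_rpow hd.le ((hgrid.step_le k hk).trans hmax) hα.le
      rw [h1, hc₀, sub_sub_cancel, mul_div_assoc']
      gcongr
    · have h1 := hy.initial 0 (Nat.ceil_pos.2 hα)
      have h2 : derivOn t₀ T 0 y t₀ = y t₀ := by simp [derivOn]
      simp only [ht.left, hu.start, ← h1, h2, sub_self, norm_zero]
    · have hxk : IsInitialGrid (T - t₀) h k x := hgrid.take hk
      have h1 := htrunc h k x ⟨hpos, hle⟩ hxk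
      simp only [htx] at h1
      have h2 := hu.rule k hk1 (hk.trans hnN)
      rw [← weightZero_translate α t₀, Finset.sum_congr rfl fun j _ => by
        rw [← weight_translate α t₀], add_assoc, sum_weight_eq_sum_hat hα (t := x) hk1 hxk.lt_succ
        (fun j => f (t j) (u j)), ht.left] at h2
      have hLip : ∀ j ≤ k, ‖f (t j) (y (t j)) - f (t j) (u j)‖ ≤ L * ‖y (t j) - u j‖ := by
        intro j hj
        refine (hL (t j) ⟨?_, ?_⟩).norm_sub_le _ _
        · have := hxk.nonneg hj
          simp only [x] at this
          linarith
        · have := hxk.le_right hj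
          simp only [x] at this
          linarith
      -- truncation error and propagated error
      have h3 : y (t k) - u k
          = (y (t k) - initialTaylor α t₀ y₀ (t k) - ∑ j ∈ Finset.range k,
              (hatLeft α (x k) (x j) (x (j + 1)) • f (t j) (y (t j))
                + hatRight α (x k) (x j) (x (j + 1)) • f (t (j + 1)) (y (t (j + 1)))))
            + ∑ j ∈ Finset.range k,
              (hatLeft α (x k) (x j) (x (j + 1)) • (f (t j) (y (t j)) - f (t j) (u j))
                + hatRight α (x k) (x j) (x (j + 1)) •
                  (f (t (j + 1)) (y (t (j + 1))) - f (t (j + 1)) (u (j + 1)))) := by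
        rw [h2]
        simp only [smul_sub, Finset.sum_add_distrib, Finset.sum_sub_distrib]
        abel
      rw [h3]
      refine (norm_add_le _ _).trans (add_le_add h1 ?_)
      rw [Finset.mul_sum]
      refine (norm_sum_le _ _).trans (Finset.sum_le_sum fun j hj => ?_)
      have hjk := Finset.mem_range.1 hj
      have hl0 := hatLeft_nonneg hα (hxk.lt_succ j hjk) (hxk.mono hjk le_rfl)
      have hr0 := hatRight_nonneg hα (hxk.lt_succ j hjk) (hxk.mono hjk le_rfl)
      refine (norm_add_le _ _).trans ?_
      rw [norm_smul, norm_smul, Real.norm_of_nonneg hl0, Real.norm_of_nonneg hr0]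
      have h4 := mul_le_mul_of_nonneg_left (hLip j hjk.le) hl0
      have h5 := mul_le_mul_of_nonneg_left (hLip (j + 1) hjk) hr0
      calc _ ≤ _ := add_le_add h4 h5
        _ = _ := by ring
  exact hC n x _ _ _ _ hsys n le_rfl

theorem errorProfile_le {α : ℝ} {h s : ℝ} (hh : 0 < h) (hs : 0 < s) :
    errorProfile α h s ≤ 2 * (s ^ (α - 1) * h ^ (1 + α) + h ^ 2) := by
  have h0 : 0 ≤ s ^ (α - 1) * h ^ (1 + α) := by positivity
  have h2 : 0 ≤ h ^ 2 := by positivity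
  unfold errorProfile
  rcases le_or_gt 1 α with h1 | h1
  · rw [min_eq_right h1, sub_self, Real.rpow_zero, one_mul, one_add_one_eq_two, Real.rpow_two]
    linarith
  · rw [min_eq_left h1.le]
    have : (s + h) ^ (α - 1) ≤ s ^ (α - 1) :=
      Real.rpow_le_rpow_of_nonpos hs (by linarith) (by linarith)
    have := mul_le_mul_of_nonneg_right this (by positivity : 0 ≤ h ^ (1 + α))
    linarith

theorem errorProfile_le_of_le {α : ℝ} (hα1 : α < 1) {h s d T : ℝ} (hh : 0 < h) (hhT : h ≤ T)
    (hd : 0 < d) (hds : d ≤ s) :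
    errorProfile α h s ≤ (d ^ (α - 1) + T ^ (1 - α)) * h ^ (1 + α) := by
  unfold errorProfile
  rw [min_eq_left hα1.le, add_mul]
  have h1 : (s + h) ^ (α - 1) ≤ d ^ (α - 1) :=
    Real.rpow_le_rpow_of_nonpos hd (by linarith) (by linarith)
  have h2 : h ^ 2 = h ^ (1 - α) * h ^ (1 + α) := by
    rw [← Real.rpow_add hh, ← Real.rpow_two]
    ring_nf
  have h3 : h ^ (1 - α) ≤ T ^ (1 - α) := Real.rpow_le_rpow hh.le hhT (by linarith)
  rw [h2]
  gcongr

end Assembly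

end FracTrap

theorem theorem1 {E : Type*} [NormedAddCommGroup E] [NormedSpace ℝ E] [FiniteDimensional ℝ E]
    (α t₀ T : ℝ) (hα : 0 < α) (hT : t₀ < T)
    (f : ℝ → E → E)
    (hf : ContDiffOn ℝ 2 (Function.uncurry f) (Set.Icc t₀ T ×ˢ Set.univ))
    (L : NNReal) (hL : ∀ t ∈ Set.Icc t₀ T, LipschitzWith L (f t))
    (y₀ : ℕ → E) (y : ℝ → E) (hy : FracTrap.IsCaputoSolution α t₀ T f y₀ y)
    (hbar : ℝ) (hbar_pos : 0 < hbar) (hbar_lt : (L : ℝ) * hbar ^ α < Real.Gamma (α + 2)) :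
    (∃ C : ℝ, ∀ (N : ℕ) (t : ℕ → ℝ) (u : ℕ → E),
      FracTrap.IsGrid t₀ T N t → FracTrap.IsPITrapezoidal α f y₀ N t u →
      ∀ n, 1 ≤ n → n ≤ N → FracTrap.maxStep t n ≤ hbar →
        ‖y (t n) - u n‖ ≤ C * ((t n - t₀) ^ (α - 1) * FracTrap.maxStep t n ^ (1 + α)
          + FracTrap.maxStep t n ^ 2)) ∧
    (α < 1 → ∀ δ : ℝ, 0 < δ → ∃ C : ℝ, ∀ (N : ℕ) (t : ℕ → ℝ) (u : ℕ → E),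
      FracTrap.IsGrid t₀ T N t → FracTrap.IsPITrapezoidal α f y₀ N t u →
      ∀ n, 1 ≤ n → n ≤ N → FracTrap.maxStep t n ≤ hbar → t₀ + δ ≤ t n →
        ‖y (t n) - u n‖ ≤ C * FracTrap.maxStep t n ^ (1 + α)) := by
  obtain ⟨C, hC0, hC⟩ :=
    FracTrap.exists_error_le_errorProfile hα hT hf hL hy hbar_lt
  refine ⟨⟨C * 2, fun N t u ht hu n hn hnN hmax => ?_⟩, fun hα1 δ hδ =>
    ⟨C * (δ ^ (α - 1) + (T - t₀) ^ (1 - α)), fun N t u ht hu n hn hnN hmax htn => ?_⟩⟩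
  · obtain ⟨hpos, hle, hbound⟩ := hC N t u ht hu n hn hnN hmax
    have htn : 0 < t n - t₀ := by
      have hmono : ∀ k, 1 ≤ k → k ≤ N → t 0 < t k := by
        intro k hk
        induction k, hk using Nat.le_induction with
        | base => exact fun h => ht.lt_succ 0 h
        | succ k hk ih => exact fun h => (ih (by omega)).trans (ht.lt_succ k h)
      have := hmono n hn hnN
      rw [ht.left] at this
      linarith
    rw [mul_assoc]
    exact hbound.trans (mul_le_mul_of_nonneg_left (FracTrap.errorProfile_le hpos htn) hC0)
  · obtain ⟨hpos, hle, hbound⟩ := hC N t u ht hu n hn hnN hmax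
    rw [mul_assoc]
    exact hbound.trans (mul_le_mul_of_nonneg_left
      (FracTrap.errorProfile_le_of_le hα1 hpos hle hδ (by linarith)) hC0)
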